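/- Let $r\ge 0$ and $d\ge 1$ be integers and let $R$ be a commutative ring such that either $\operatorname{char} R=p$ is a prime with $p>d$, or $\mathbb{Q}\subset R$. A class $h=\sum_{n<d}h_ns^n\in R[y_1,\dots,y_r][[s]]/\langle s^d\rangle$ is called regular in $\mathbf y$ if the total degree $\deg_{\mathbf y}h_n$ is at most $n$ for all $n<d$. (1) If $h\in R[y_1,\dots,y_r][[s]]/\langle s^d\rangle$ is regular in $\mathbf y$ and $h_0=0$, then $e^{h} \bmod s^d=\sum_{n<d}h^n/n! \bmod s^d$ is regular in $\mathbf y$. (2) Suppose moreover that $R$ supports the fast Fourier transform, i.e. that for every $k\ge 0$ it has a primitive $2^k$-th root of unity $\omega_k$ (an $\omega\in R$ is a primitive $m$-th root of unity if $\omega^m=1$, $m$ is a unit in $R$, and $\omega^{m/t}-1$ is not a zero divisor for every prime $t\mid m$). Then, for $h$ as in (1), $e^h\bmod s^d$ can be computed in $O((r+1)\,d^{r+1}\log d)$ operations in $R$. Precisely: there is an absolute constant $C$ such that for all $r\ge 0$ and $d\ge1$ there is a straight-line program, performing at most $C(r+1)d^{r+1}\log d$ additions, subtractions, multiplications and divisions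 by integers, with $1$ and the $\omega_k$ as its only constants, which for every such ring $R$, every choice of the $\omega_k$, and every such $h$ computes from the coefficients in $R$ of the monomials $\mathbf y^{\alpha}s^n$ $(n<d,\ |\alpha|\le n)$ of $h$ the coefficients of these monomials in $e^h \bmod s^d$. -/

import Mathlib

universe u

namespace RegularExp

noncomputable section

/-- The ring `R[y_1, …, y_r][[s]] / ⟨s ^ d⟩`; the variable `s` is `PowerSeries.X`. -/
abbrev SeriesMod (R : Type u) [CommRing R] (r d : ℕ) : Type u :=
  PowerSeries (MvPolynomial (Fin r) R) ⧸
    Ideal.span {(PowerSeries.X : PowerSeries (MvPolynomial (Fin r) R)) ^ d}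

/-- The coefficient `h_n ∈ R[y_1, …, y_r]` of `s ^ n`, for `n < d`, of a class modulo `s ^ d`. -/
def coeffMod {R : Type u} [CommRing R] {r d : ℕ} (n : Fin d) (h : SeriesMod R r d) :
    MvPolynomial (Fin r) R :=
  Quotient.liftOn' h (fun f => PowerSeries.coeff (n : ℕ) f) (by
    intro f g hfg
    have h1 : f - g ∈ Ideal.span
        {(PowerSeries.X : PowerSeries (MvPolynomial (Fin r) R)) ^ d} :=
      (Submodule.quotientRel_def _).1 hfg
    have h2 := PowerSeries.X_pow_dvd_iff.1 (Ideal.mem_span_singleton.1 h1) n n.isLt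
    rw [map_sub] at h2
    exact sub_eq_zero.1 h2)

theorem coeffMod_mk {R : Type u} [CommRing R] {r d : ℕ} (n : Fin d)
    (f : PowerSeries (MvPolynomial (Fin r) R)) :
    coeffMod n (Ideal.Quotient.mk _ f : SeriesMod R r d) = PowerSeries.coeff (n : ℕ) f :=
  rfl

/-- `h mod s ^ d` is regular in `y`: the total degree of `h_n` is at most `n` for all `n < d`. -/
def IsRegularInY {R : Type u} [CommRing R] {r d : ℕ} (h : SeriesMod R r d) : Prop :=
  ∀ n : Fin d, (coeffMod n h).totalDegree ≤ (n : ℕ)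

/-- `e ^ h mod s ^ d`, that is `∑ h ^ n / n!`. When `h_0 = 0`, the power `h ^ n` vanishes modulo
`s ^ d` for `n ≥ d`, so that only the terms with `n < d` occur; `n!` is invertible for `n < d`
under the hypothesis `HasSmallInverses` below. -/
def expMod {R : Type u} [CommRing R] {r d : ℕ} (h : SeriesMod R r d) : SeriesMod R r d :=
  ∑ n ∈ Finset.range d, Ring.inverse (n.factorial : SeriesMod R r d) * h ^ n

/-- `char R` is a prime `p > d`, or `ℚ ⊂ R`. -/
def HasSmallInverses (R : Type u) [CommRing R] (d : ℕ) : Prop :=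
  (∃ p : ℕ, p.Prime ∧ d < p ∧ CharP R p) ∨ (∃ f : ℚ →+* R, Function.Injective f)

/-- Primitive `n`-th roots of unity in a commutative ring, as used for the fast Fourier
transform: `ω ^ n = 1`, `n` is a unit of `R`, and `ω ^ (n / t) - 1` is not a zero divisor for any
prime divisor `t` of `n`. (On rings with zero divisors this is stronger than `IsPrimitiveRoot`.) -/
def IsFFTRoot {R : Type u} [CommRing R] (ω : R) (n : ℕ) : Prop :=
  ω ^ n = 1 ∧ IsUnit (n : R) ∧
    ∀ t : ℕ, t.Prime → t ∣ n → ω ^ (n / t) - 1 ∈ nonZeroDivisors R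

/-- `ω k` is a primitive `2 ^ k`-th root of unity for every `k`. The ring `R` supports the fast
Fourier transform if and only if there is such a family. -/
def IsFFTFamily {R : Type u} [CommRing R] (ω : ℕ → R) : Prop :=
  ∀ k : ℕ, IsFFTRoot (ω k) (2 ^ k)

/-! Straight-line programs over a commutative ring. They never mention the ring, so that the same
program can be run over every ring in which the roots of unity have been chosen. -/

/-- What an instruction can read: an input, the constant `1`, the primitive `2 ^ k`-th root of
unity, or the result of the `j`-th instruction (counted from `0`). -/
inductive Operand (ι : Type) : Type
  | input (i : ι)
  | one
  | root (k : ℕ)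
  | reg (j : ℕ)

/-- One operation in `R`: addition, subtraction, multiplication, or division by an integer. -/
inductive Instr (ι : Type) : Type
  | add (a b : Operand ι)
  | sub (a b : Operand ι)
  | mul (a b : Operand ι)
  | divNat (a : Operand ι) (n : ℕ)

/-- A straight-line program with inputs indexed by `ι` and outputs indexed by `κ`. -/
structure Program (ι κ : Type) : Type where
  instrs : List (Instr ι)
  output : κ → Operand ι

/-- The number of ring operations that the program performs. -/
def Program.cost {ι κ : Type} (P : Program ι κ) : ℕ := P.instrs.length

section Semantics

variable {R : Type u} [CommRing R] {ι κ : Type}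

/-- The value of an operand; `regs` lists the results of the instructions executed so far. -/
def Operand.eval (ω : ℕ → R) (x : ι → R) (regs : List R) : Operand ι → R
  | .input i => x i
  | .one => 1
  | .root k => ω k
  | .reg j => regs.getD j 0

def Instr.eval (ω : ℕ → R) (x : ι → R) (regs : List R) : Instr ι → R
  | .add a b => a.eval ω x regs + b.eval ω x regs
  | .sub a b => a.eval ω x regs - b.eval ω x regs
  | .mul a b => a.eval ω x regs * b.eval ω x regs
  | .divNat a n => a.eval ω x regs * Ring.inverse (n : R)

/-- Execute the instructions one after the other, appending each result to `regs`. -/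
def runInstrs (ω : ℕ → R) (x : ι → R) : List (Instr ι) → List R → List R
  | [], regs => regs
  | c :: cs, regs => runInstrs ω x cs (regs ++ [c.eval ω x regs])

/-- The outputs of the program on the input `x`. -/
def Program.eval (P : Program ι κ) (ω : ℕ → R) (x : ι → R) (q : κ) : R :=
  (P.output q).eval ω x (runInstrs ω x P.instrs [])

end Semantics

/-- The monomials `y ^ α * s ^ n` with `n < d` and `|α| ≤ n`, i.e. those that can occur in a
series modulo `s ^ d` that is regular in `y`. -/
abbrev RegMonomial (r d : ℕ) : Type :=
  {q : Fin d × (Fin r →₀ ℕ) // q.2.degree ≤ (q.1 : ℕ)}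

/-- The table of the coefficients of `h` in `R`; it determines `h` if `h` is regular. -/
def coeffTable {R : Type u} [CommRing R] {r d : ℕ} (h : SeriesMod R r d)
    (q : RegMonomial r d) : R :=
  MvPolynomial.coeff q.1.2 (coeffMod q.1.1 h)

end

end RegularExp

-- Total degrees in the `y` variables add under multiplication just as powers of `s` do, so the
-- regular series form an `R`-subalgebra. As `e ^ h` is a polynomial in `h` over `R`, it is regular.
--
-- For the complexity, regularity makes Kronecker substitution faithful. Sending the variable of
-- index `i` to `X ^ d ^ i` and `s` to `X ^ d ^ r`, the monomials with `|α| ≤ n < d` get distinct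
-- exponents below `N = d ^ (r + 1)` (`code_injective`), and truncation at `s ^ m` becomes
-- truncation at `X ^ (m * d ^ r)` (`coeff_kron_congr`). So univariate FFT multiplication applies
-- (`Computes.mul`). The derivation `θ = s d/ds` acts on encoded series by multiplying coefficient
-- `e` by `e / d ^ r` (`coeff_kron_theta`); integration thus divides only by positive integers below
-- `d`, which are units.
--
-- The series `F = e ^ h` and `F' = e ^ (-h)` are computed together by Newton iteration from `θF =
-- θh * F` and `F * F' = 1` (`Computes.newton`). Each step at most doubles the precision in `s` and
-- uses five products. The costs form a geometric sum, so the total is `O(N log N)`, with `log N =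
-- (r + 1) log d`.
--
-- The predicate `Computes` concerns a single ring and a single input. A program valid for all rings
-- and inputs at once comes from applying it to the product of the rings of all problems, with the
-- tuple of all inputs as one input. Projections commute with a program that divides only by units
-- (`Program.eval_map`).

universe v

namespace RegularExp

/-! ### Operation counts in a ring, and extraction of straight-line programs -/

section StraightLine

variable {R : Type v} [CommRing R]

/-- `z` is the result of one operation on elements of `B`; division is only by units. -/
inductive IsOp (B : Set R) : R → Prop
  | add {a b : R} (ha : a ∈ B) (hb : b ∈ B) : IsOp B (a + b)
  | sub {a b : R} (ha : a ∈ B) (hb : b ∈ B) : IsOp B (a - b)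
  | mul {a b : R} (ha : a ∈ B) (hb : b ∈ B) : IsOp B (a * b)
  | divNat {a : R} {n : ℕ} (ha : a ∈ B) (hn : IsUnit (n : R)) : IsOp B (a * Ring.inverse (n : R))

theorem IsOp.mono {B B' : Set R} {z : R} (h : IsOp B z) (hB : B ⊆ B') : IsOp B' z := by
  cases h with
  | add ha hb => exact .add (hB ha) (hB hb)
  | sub ha hb => exact .sub (hB ha) (hB hb)
  | mul ha hb => exact .mul (hB ha) (hB hb)
  | divNat ha hn => exact .divNat (hB ha) hn

/-- All elements of `T` can be obtained from elements of `B` with at most `c` operations. -/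
inductive Computes : Set R → ℕ → Set R → Prop
  | done {B T : Set R} {c : ℕ} (h : T ⊆ B) : Computes B c T
  | step {B T : Set R} {c : ℕ} {z : R} (hz : IsOp B z) (h : Computes (insert z B) c T) :
      Computes B (c + 1) T

namespace Computes

variable {B B' T T' : Set R} {c c' : ℕ}

theorem mono (h : Computes B c T) (hB : B ⊆ B') : Computes B' c T := by
  induction h generalizing B' with
  | done h => exact .done (h.trans hB)
  | step hz _ ih => exact .step (hz.mono hB) (ih (Set.insert_subset_insert hB))

theorem weaken (h : Computes B c T) (hc : c ≤ c') : Computes B c' T := by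
  induction h generalizing c' with
  | done h => exact .done h
  | step hz _ ih =>
    obtain ⟨e, rfl⟩ := Nat.exists_eq_add_of_le' (show 1 ≤ c' by omega)
    exact .step hz (ih (by omega))

theorem subset (h : Computes B c T) (hT : T' ⊆ T) : Computes B c T' := by
  induction h with
  | done h => exact .done (hT.trans h)
  | step hz _ ih => exact .step hz (ih hT)

theorem trans (h : Computes B c T) (h' : Computes (B ∪ T) c' T') : Computes B (c + c') T' := by
  induction h with
  | done h => exact (h'.mono (Set.union_subset subset_rfl h)).weaken (by omega)
  | step hz _ ih =>
    rw [Nat.add_right_comm]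
    exact .step hz (ih (h'.mono (Set.union_subset_union_left _ (Set.subset_insert _ _))))

/-- Chain two computations, where the second one may start from any larger set. -/
theorem bind {t : ℕ} (h : Computes B c T) (ht : c + c' ≤ t)
    (h' : ∀ B', B ⊆ B' → T ⊆ B' → Computes B' c' T') : Computes B t T' :=
  (h.trans (h' _ Set.subset_union_left Set.subset_union_right)).weaken ht

theorem of_isOp {ι : Type*} {f : ι → R} (s : Finset ι) (h : ∀ i ∈ s, IsOp B (f i)) :
    Computes B s.card (f '' s) := by
  classical
  induction s using Finset.induction_on generalizing B with
  | empty => exact .done (by simp)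
  | insert a s ha ih =>
    rw [Finset.card_insert_of_notMem ha]
    refine .step (h a (Finset.mem_insert_self a s)) ?_
    have h1 := ih (B := insert (f a) B) fun i hi =>
      (h i (Finset.mem_insert_of_mem hi)).mono (Set.subset_insert _ _)
    refine (h1.trans (c' := 0) (.done (T := f '' ((insert a s : Finset ι) : Set ι)) ?_))
    rintro _ ⟨i, hi, rfl⟩
    rcases Finset.mem_insert.1 (Finset.mem_coe.1 hi) with rfl | hi
    · exact Or.inl (Set.mem_insert _ _)
    · exact Or.inr ⟨i, hi, rfl⟩

/-- The elements with indices below `n`. -/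
theorem of_isOp_lt {f : ℕ → R} (n : ℕ) (h : ∀ i < n, IsOp B (f i)) :
    Computes B n (f '' Set.Iio n) := by
  have := of_isOp (B := B) (f := f) (Finset.range n) fun i hi => h i (Finset.mem_range.1 hi)
  simpa using this

theorem of_isOp_succ {f : ℕ → R} (n : ℕ) (h0 : f 0 ∈ B)
    (h : ∀ B' : Set R, B ⊆ B' → ∀ i < n, f i ∈ B' → IsOp B' (f (i + 1))) :
    Computes B n (f '' Set.Iic n) := by
  induction n with
  | zero =>
    refine .done ?_
    rintro _ ⟨i, hi, rfl⟩
    rw [Set.mem_Iic, Nat.le_zero] at hi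
    exact hi ▸ h0
  | succ n ih =>
    refine (ih fun B' hB i hi => h B' hB i (by omega)).bind (c' := 1) le_rfl fun B' hB hT => ?_
    refine .step (h B' hB n (by omega) (hT ⟨n, Set.mem_Iic.2 le_rfl, rfl⟩)) (.done ?_)
    rintro _ ⟨i, hi, rfl⟩
    rcases Nat.lt_or_ge i (n + 1) with hi' | hi'
    · exact Or.inr (hT ⟨i, Set.mem_Iic.2 (Nat.lt_succ_iff.1 hi'), rfl⟩)
    · exact Or.inl (by rw [show i = n + 1 from le_antisymm hi hi'])

end Computes

/-- A straight-line program whose registers, evaluated on `x`, contain the elements of `T`,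
and which commutes with ring homomorphisms. -/
theorem Computes.exists_instrs {ι : Type} (ω : ℕ → R) (x : ι → R) {B T : Set R} {c : ℕ}
    (h : Computes B c T) (regs : List R)
    (hB : ∀ b ∈ B, ∃ o : Operand ι, (∀ j, o = .reg j → j < regs.length) ∧ o.eval ω x regs = b) :
    ∃ cs : List (Instr ι), cs.length ≤ c ∧
      (∀ a n, Instr.divNat a n ∈ cs → IsUnit (n : R)) ∧
      ∀ t ∈ T, ∃ o : Operand ι, o.eval ω x (runInstrs ω x cs regs) = t := by
  induction h generalizing regs with
  | done h =>
    refine ⟨[], Nat.zero_le _, by simp, fun t ht => ?_⟩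
    obtain ⟨o, -, ho⟩ := hB t (h ht)
    exact ⟨o, ho⟩
  | @step B T c z hz _ ih =>
    obtain ⟨i, hi, hu⟩ : ∃ i : Instr ι, i.eval ω x regs = z ∧
        ∀ a n, Instr.divNat a n = i → IsUnit (n : R) := by
      cases hz with
      | add ha hb =>
        obtain ⟨o, -, rfl⟩ := hB _ ha
        obtain ⟨o', -, rfl⟩ := hB _ hb
        exact ⟨.add o o', rfl, by simp⟩
      | sub ha hb =>
        obtain ⟨o, -, rfl⟩ := hB _ ha
        obtain ⟨o', -, rfl⟩ := hB _ hb
        exact ⟨.sub o o', rfl, by simp⟩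
      | mul ha hb =>
        obtain ⟨o, -, rfl⟩ := hB _ ha
        obtain ⟨o', -, rfl⟩ := hB _ hb
        exact ⟨.mul o o', rfl, by simp⟩
      | @divNat a n ha hn =>
        obtain ⟨o, -, rfl⟩ := hB _ ha
        refine ⟨.divNat o n, rfl, ?_⟩
        rintro a m ⟨⟩
        exact hn
    -- Operands refer only to existing registers, so appending `z` does not change their values; an
    -- index past the end would have read the default `0`.
    obtain ⟨cs, hc, hcs, hT⟩ := ih (regs ++ [z]) (by
      intro b hb
      rcases hb with rfl | hb
      · exact ⟨.reg regs.length, by simp, by simp [Operand.eval]⟩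
      · obtain ⟨o, ho, rfl⟩ := hB b hb
        refine ⟨o, fun j hj => (ho j hj).trans (by simp), ?_⟩
        cases o with
        | reg j => exact List.getD_append _ _ _ _ (ho j rfl)
        | _ => rfl)
    refine ⟨i :: cs, by simpa using hc, fun a n h => ?_, fun t ht => ?_⟩
    · rcases List.mem_cons.1 h with h | h
      · exact hu a n h
      · exact hcs a n h
    · rw [runInstrs, hi]
      exact hT t ht

theorem Computes.exists_program {ι κ : Type} (ω : ℕ → R) (x : ι → R) {B T : Set R} {c : ℕ}
    (h : Computes B c T) (hB : ∀ b ∈ B, b = 1 ∨ b ∈ Set.range ω ∨ b ∈ Set.range x)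
    (f : κ → R) (hf : ∀ q, f q ∈ T) :
    ∃ P : Program ι κ, P.cost ≤ c ∧ (∀ a n, Instr.divNat a n ∈ P.instrs → IsUnit (n : R)) ∧
      ∀ q, P.eval ω x q = f q := by
  obtain ⟨cs, hc, hu, hT⟩ := h.exists_instrs ω x [] (by
    intro b hb
    rcases hB b hb with rfl | ⟨k, rfl⟩ | ⟨i, rfl⟩
    · exact ⟨.one, by simp, rfl⟩
    · exact ⟨.root k, by simp, rfl⟩
    · exact ⟨.input i, by simp, rfl⟩)
  choose o ho using fun q => hT (f q) (hf q)
  exact ⟨⟨cs, o⟩, hc, hu, ho⟩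

variable {S : Type u} [CommRing S] {ι κ : Type}

theorem map_inverse_of_isUnit (π : R →+* S) {a : R} (ha : IsUnit a) :
    π (Ring.inverse a) = Ring.inverse (π a) := by
  obtain ⟨a, rfl⟩ := ha
  rw [Ring.inverse_unit]
  exact (Ring.inverse_unit (Units.map (π : R →* S) a)).symm

theorem Operand.eval_map (π : R →+* S) (ω : ℕ → R) (x : ι → R) (regs : List R) (o : Operand ι) :
    o.eval (π ∘ ω) (π ∘ x) (regs.map π) = π (o.eval ω x regs) := by
  cases o with
  | reg j =>
    rw [Operand.eval, Operand.eval, ← map_zero π, List.getD_map]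
  | one => exact (map_one π).symm
  | _ => rfl

theorem runInstrs_map (π : R →+* S) (ω : ℕ → R) (x : ι → R) (cs : List (Instr ι)) (regs : List R)
    (h : ∀ a n, Instr.divNat a n ∈ cs → IsUnit (n : R)) :
    runInstrs (π ∘ ω) (π ∘ x) cs (regs.map π) = (runInstrs ω x cs regs).map π := by
  induction cs generalizing regs with
  | nil => rfl
  | cons i cs ih =>
    have hi : i.eval (π ∘ ω) (π ∘ x) (regs.map π) = π (i.eval ω x regs) := by
      cases i with
      | divNat a n =>
        simp only [Instr.eval, Operand.eval_map, map_mul]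
        rw [map_inverse_of_isUnit π (h a n (by simp)), map_natCast]
      | _ => simp only [Instr.eval, Operand.eval_map, map_mul, map_add, map_sub]
    rw [runInstrs, runInstrs, hi, ← ih _ fun a n ha => h a n (List.mem_cons_of_mem _ ha)]
    simp

theorem Program.eval_map (π : R →+* S) (ω : ℕ → R) (x : ι → R) (P : Program ι κ)
    (h : ∀ a n, Instr.divNat a n ∈ P.instrs → IsUnit (n : R)) (q : κ) :
    P.eval (π ∘ ω) (π ∘ x) q = π (P.eval ω x q) := by
  have := runInstrs_map π ω x P.instrs [] h
  rw [List.map_nil] at this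
  rw [Program.eval, this, Operand.eval_map, Program.eval]

end StraightLine

/-! ### The discrete Fourier transform of length a power of two -/

section FourierTransform

variable {R : Type v} [CommRing R]

/-- The discrete Fourier transform of length `2 ^ k`. -/
def dft (k : ℕ) (a : ℕ → R) (w : R) (i : ℕ) : R :=
  ∑ j ∈ Finset.range (2 ^ k), a j * w ^ (i * j)

theorem sum_range_two_mul {M : Type*} [AddCommMonoid M] (f : ℕ → M) (n : ℕ) :
    ∑ i ∈ Finset.range (2 * n), f i =
      ∑ i ∈ Finset.range n, f (2 * i) + ∑ i ∈ Finset.range n, f (2 * i + 1) := by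
  induction n with
  | zero => simp
  | succ n ih =>
    rw [Nat.mul_succ, Finset.sum_range_succ, Finset.sum_range_succ, ih, Finset.sum_range_succ,
      Finset.sum_range_succ]
    abel

theorem dft_succ (k : ℕ) (a : ℕ → R) (w : R) (i : ℕ) :
    dft (k + 1) a w i =
      dft k (fun j => a (2 * j)) (w ^ 2) i + w ^ i * dft k (fun j => a (2 * j + 1)) (w ^ 2) i := by
  rw [dft, pow_succ', sum_range_two_mul, dft, dft, Finset.mul_sum]
  congr 1
  · exact Finset.sum_congr rfl fun j _ => by ring
  · exact Finset.sum_congr rfl fun j _ => by ring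

theorem dft_mod (k : ℕ) (a : ℕ → R) {w : R} (hw : w ^ 2 ^ k = 1) (i : ℕ) :
    dft k a w (i % 2 ^ k) = dft k a w i := by
  refine Finset.sum_congr rfl fun j _ => ?_
  conv_rhs => rw [← Nat.div_add_mod i (2 ^ k)]
  rw [add_mul, pow_add, mul_assoc, pow_mul w (2 ^ k), hw, one_pow, one_mul]

/-- Radix-two recursion: the cost satisfies `T(k+1) = 2 T(k) + 2 * 2 ^ (k+1)`, one product and one
sum per output. Periodicity leaves only `2 ^ k` outputs to compute. -/
theorem Computes.fourier {B : Set R} (k : ℕ) {a : ℕ → R} {w : R} (hw : w ^ 2 ^ k = 1)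
    (ha : ∀ j < 2 ^ k, a j ∈ B) (hB : ∀ i, w ^ i ∈ B) :
    Computes B (2 * k * 2 ^ k) (Set.range (dft k a w)) := by
  induction k generalizing a w B with
  | zero =>
    refine .done ?_
    rintro _ ⟨i, rfl⟩
    simpa [dft] using ha 0 (by simp)
  | succ k ih =>
    have hw' : (w ^ 2) ^ 2 ^ k = 1 := by rw [← pow_mul, ← pow_succ', hw]
    have hB' : ∀ i, (w ^ 2) ^ i ∈ B := fun i => by rw [← pow_mul]; exact hB _
    refine (ih (a := fun j => a (2 * j)) hw' (fun j hj => ha _ (by rw [pow_succ]; omega)) hB').bind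
      (c' := 2 * k * 2 ^ k + 2 * 2 ^ (k + 1)) (by rw [pow_succ]; nlinarith)
      fun B₁ h₁ hE => ?_
    refine (ih (a := fun j => a (2 * j + 1)) hw'
      (fun j hj => h₁ (ha _ (by rw [pow_succ]; omega))) (fun i => h₁ (hB' i))).bind
      (c' := 2 * 2 ^ (k + 1)) le_rfl fun B₂ h₂ hO => ?_
    refine (Computes.of_isOp_lt (f := fun i =>
      w ^ i * dft k (fun j => a (2 * j + 1)) (w ^ 2) i) (2 ^ (k + 1))
      fun i _ => .mul (h₂ (h₁ (hB i))) (hO ⟨i, rfl⟩)).bind (c' := 2 ^ (k + 1)) (by omega)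
      fun B₃ h₃ hP => ?_
    refine (Computes.of_isOp_lt (f := dft (k + 1) a w) (2 ^ (k + 1))
      fun i hi => ?_).subset ?_
    · rw [dft_succ]
      exact .add (h₃ (h₂ (hE ⟨i, rfl⟩))) (hP ⟨i, hi, rfl⟩)
    · rintro _ ⟨i, rfl⟩
      exact ⟨i % 2 ^ (k + 1), Nat.mod_lt _ (by positivity), dft_mod _ _ hw i⟩

/-- The second half of the sum is `(-1) ^ m` times the first. For odd `m` they cancel; for even `m`
the first half vanishes by recursion on `w ^ 2`. No cancellation of a factor is needed, so zero
divisors do no harm. -/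
theorem sum_pow_mul_eq_zero (k : ℕ) {w : R} (hw : w ^ 2 ^ k = -1) {m : ℕ}
    (hm : ¬ 2 ^ (k + 1) ∣ m) : ∑ i ∈ Finset.range (2 ^ (k + 1)), w ^ (i * m) = 0 := by
  have key : ∑ i ∈ Finset.range (2 ^ (k + 1)), w ^ (i * m) =
      ∑ i ∈ Finset.range (2 ^ k), (w ^ (i * m) + w ^ (i * m) * (-1) ^ m) := by
    rw [pow_succ, mul_two, Finset.sum_range_add, ← Finset.sum_add_distrib]
    refine Finset.sum_congr rfl fun i _ => ?_
    rw [add_mul, pow_add, pow_mul w (2 ^ k), hw, mul_comm (_ ^ m)]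
  rcases Nat.even_or_odd' m with ⟨m, rfl | rfl⟩
  · cases k with
    | zero => exact absurd (by simp) hm
    | succ k =>
      have ih := sum_pow_mul_eq_zero k (w := w ^ 2) (by rw [← pow_mul, ← pow_succ', hw]) (m := m)
        (fun h => hm (by rw [pow_succ']; exact Nat.mul_dvd_mul_left 2 h))
      rw [key, Finset.sum_add_distrib, ← Finset.sum_mul]
      have : ∑ i ∈ Finset.range (2 ^ (k + 1)), w ^ (i * (2 * m)) = 0 := by
        rw [← ih]
        exact Finset.sum_congr rfl fun i _ => by ring
      rw [this, zero_mul, zero_add]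
  · rw [key]
    refine Finset.sum_eq_zero fun i _ => ?_
    rw [pow_succ (-1 : R), pow_mul (-1 : R)]
    ring

theorem IsFFTRoot.sum_pow_mul {k : ℕ} {w : R} (hw : IsFFTRoot w (2 ^ k)) (m : ℕ) :
    ∑ i ∈ Finset.range (2 ^ k), w ^ (i * m) = if 2 ^ k ∣ m then 2 ^ k else 0 := by
  split_ifs with h
  · obtain ⟨m, rfl⟩ := h
    rw [Finset.sum_congr rfl fun i _ => show w ^ (i * (2 ^ k * m)) = 1 by
      rw [mul_left_comm, pow_mul, hw.1, one_pow]]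
    simp
  · cases k with
    | zero => simp at h
    | succ k =>
      refine sum_pow_mul_eq_zero k ?_ h
      have h2 := hw.2.2 2 Nat.prime_two (dvd_pow_self 2 (by omega))
      rw [show 2 ^ (k + 1) / 2 = 2 ^ k by omega] at h2
      have h3 : (w ^ 2 ^ k + 1) * (w ^ 2 ^ k - 1) = 0 := by
        have := hw.1
        rw [pow_succ, pow_mul] at this
        linear_combination this
      exact eq_neg_of_add_eq_zero_left ((mul_right_mem_nonZeroDivisors_eq_zero_iff h2).1 h3)

open Polynomial in
theorem dft_coeff {k : ℕ} {p : R[X]} (hp : p.natDegree < 2 ^ k) (w : R) (i : ℕ) :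
    dft k p.coeff w i = p.eval (w ^ i) := by
  rw [eval_eq_sum_range' hp, dft]
  exact Finset.sum_congr rfl fun j _ => by rw [pow_mul]

open Polynomial in
theorem IsFFTRoot.dft_eval {k : ℕ} {w : R} (hw : IsFFTRoot w (2 ^ k)) {p : R[X]}
    (hp : p.natDegree < 2 ^ k) {j : ℕ} (hj : j < 2 ^ k) :
    dft k (fun i => p.eval (w ^ i)) (w ^ (2 ^ k - 1)) j = p.coeff j * 2 ^ k := by
  have h1 : ∀ i, p.eval (w ^ i) * (w ^ (2 ^ k - 1)) ^ (j * i) =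
      ∑ l ∈ Finset.range (2 ^ k), p.coeff l * w ^ (i * (l + (2 ^ k - 1) * j)) := by
    intro i
    rw [eval_eq_sum_range' hp, Finset.sum_mul]
    exact Finset.sum_congr rfl fun l _ => by ring
  rw [dft, Finset.sum_congr rfl fun i _ => h1 i, Finset.sum_comm]
  simp_rw [← Finset.mul_sum, hw.sum_pow_mul]
  rw [Finset.sum_eq_single j]
  · rw [if_pos]
    obtain ⟨n, hn⟩ := Nat.exists_eq_add_of_le' (Nat.one_le_two_pow (n := k))
    rw [hn, Nat.add_sub_cancel]
    exact ⟨j, by ring⟩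
  · intro l hl hlj
    rw [if_neg, mul_zero]
    intro hdvd
    apply hlj
    rw [Finset.mem_range] at hl
    have h2 : 2 ^ k ∣ (l + (2 ^ k - 1) * j) + j ↔ 2 ^ k ∣ j := Nat.dvd_add_right hdvd
    have h3 : (l + (2 ^ k - 1) * j) + j = l + 2 ^ k * j := by
      obtain ⟨n, hn⟩ := Nat.exists_eq_add_of_le' (Nat.one_le_two_pow (n := k))
      rw [hn, Nat.add_sub_cancel]
      ring
    have h4 : (l + 2 ^ k * j) ≡ j [MOD 2 ^ k] := by
      rw [← h3]
      simpa using ((Nat.modEq_zero_iff_dvd.2 hdvd).add_right j)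
    have h5 : l ≡ j [MOD 2 ^ k] := by
      simpa [Nat.ModEq] using h4
    exact Nat.ModEq.eq_of_lt_of_lt h5 hl hj
  · intro h
    exact absurd (Finset.mem_range.2 hj) h

end FourierTransform

/-! ### Fast multiplication of truncated univariate polynomials -/

section Multiplication

open Polynomial

variable {R : Type v} [CommRing R]

/-- The coefficients of `p` below degree `n`. -/
def coeffsLT (p : R[X]) (n : ℕ) : Set R := p.coeff '' Set.Iio n

theorem coeffsLT_subset {p : R[X]} {n : ℕ} {B : Set R} :
    coeffsLT p n ⊆ B ↔ ∀ e < n, p.coeff e ∈ B := by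
  simp [coeffsLT, Set.subset_def]

/-- Truncation modulo `X ^ n`. -/
noncomputable def truncLT (n : ℕ) (p : R[X]) : R[X] := ∑ i ∈ Finset.range n, monomial i (p.coeff i)

theorem coeff_truncLT (n : ℕ) (p : R[X]) (e : ℕ) :
    (truncLT n p).coeff e = if e < n then p.coeff e else 0 := by
  simp [truncLT, coeff_monomial]

theorem natDegree_truncLT_lt {n : ℕ} (hn : 0 < n) (p : R[X]) : (truncLT n p).natDegree < n := by
  refine Nat.lt_of_le_pred hn (natDegree_le_iff_coeff_eq_zero.2 fun m hm => ?_)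
  rw [coeff_truncLT, if_neg (by rw [Nat.pred_eq_sub_one] at hm; omega)]

theorem X_pow_dvd_sub_truncLT (n : ℕ) (p : R[X]) : X ^ n ∣ p - truncLT n p := by
  rw [X_pow_dvd_iff]
  intro e he
  rw [coeff_sub, coeff_truncLT, if_pos he, sub_self]

theorem coeff_eq_of_X_pow_dvd_sub {n e : ℕ} {p q : R[X]} (h : X ^ n ∣ p - q) (he : e < n) :
    p.coeff e = q.coeff e := by
  rw [← sub_eq_zero, ← coeff_sub]
  exact X_pow_dvd_iff.1 h e he

theorem dvd_mul_sub_mul {A : Type*} [CommRing A] {s a b a' b' : A} (h : s ∣ a - a')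
    (h' : s ∣ b - b') : s ∣ a * b - a' * b' := by
  rw [show a * b - a' * b' = (a - a') * b + a' * (b - b') by ring]
  exact dvd_add (h.mul_right _) (h'.mul_left _)

/-- Since `2 * n ≤ 2 ^ k`, the product of the truncated factors does not wrap around. The cost is `2
^ k` for the powers of the root, three transforms, `2 ^ k` pointwise products and `n ≤ 2 ^ k`
divisions. -/
theorem Computes.mul_of_le {B : Set R} {ω : ℕ → R} (hω : IsFFTFamily ω) (h0 : (0 : R) ∈ B)
    (h1 : (1 : R) ∈ B) (hB : Set.range ω ⊆ B) {n k : ℕ} (hn : 0 < n) (hk : 2 * n ≤ 2 ^ k)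
    {p q : R[X]} (hp : coeffsLT p n ⊆ B) (hq : coeffsLT q n ⊆ B) :
    Computes B (6 * k * 2 ^ k + 3 * 2 ^ k) (coeffsLT (p * q) n) := by
  rw [coeffsLT_subset] at hp hq
  obtain ⟨p', hp'⟩ : ∃ p', p' = truncLT n p := ⟨_, rfl⟩
  obtain ⟨q', hq'⟩ : ∃ q', q' = truncLT n q := ⟨_, rfl⟩
  have hpB : ∀ e, p'.coeff e ∈ B := fun e => by
    rw [hp', coeff_truncLT]
    split_ifs with h
    exacts [hp e h, h0]
  have hqB : ∀ e, q'.coeff e ∈ B := fun e => by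
    rw [hq', coeff_truncLT]
    split_ifs with h
    exacts [hq e h, h0]
  have hpn : p'.natDegree < n := hp' ▸ natDegree_truncLT_lt hn p
  have hqn : q'.natDegree < n := hq' ▸ natDegree_truncLT_lt hn q
  have hpq : (p' * q').natDegree < 2 ^ k := by
    have := natDegree_mul_le (p := p') (q := q')
    omega
  have hdvd : X ^ n ∣ p * q - p' * q' := by
    rw [hp', hq']
    exact dvd_mul_sub_mul (X_pow_dvd_sub_truncLT n p) (X_pow_dvd_sub_truncLT n q)
  have hw : IsFFTRoot (ω k) (2 ^ k) := hω k
  have hwB : ω k ∈ B := hB ⟨k, rfl⟩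
  generalize ω k = w at hw hwB
  refine (Computes.of_isOp_succ (f := fun i => w ^ i) (2 ^ k) (by simpa using h1)
    fun B' hB' i _ hi => by
      rw [pow_succ]
      exact .mul hi (hB' hwB)).bind (c' := 6 * k * 2 ^ k + 2 * 2 ^ k) (by omega)
    fun B₁ hB₁ hpow => ?_
  have hpow' : ∀ i, w ^ i ∈ B₁ := fun i => by
    rw [← Nat.div_add_mod i (2 ^ k), pow_add, pow_mul, hw.1, one_pow, one_mul]
    exact hpow ⟨_, Set.mem_Iic.2 (Nat.mod_lt _ (by positivity)).le, rfl⟩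
  refine (Computes.fourier k hw.1 (a := p'.coeff) (fun j _ => hB₁ (hpB j)) hpow').bind
    (c' := 4 * k * 2 ^ k + 2 * 2 ^ k) (by ring_nf; omega) fun B₂ hB₂ hP => ?_
  refine (Computes.fourier k hw.1 (a := q'.coeff) (fun j _ => hB₂ (hB₁ (hqB j)))
    fun i => hB₂ (hpow' i)).bind
    (c' := 2 * k * 2 ^ k + 2 * 2 ^ k) (by ring_nf; omega) fun B₃ hB₃ hQ => ?_
  refine (Computes.of_isOp_lt (f := fun i => (p' * q').eval (w ^ i)) (2 ^ k) fun i _ => ?_).bind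
    (c' := 2 * k * 2 ^ k + 2 ^ k) (by omega) fun B₄ hB₄ hPQ => ?_
  · simp only [eval_mul]
    rw [← dft_coeff (k := k) (by omega), ← dft_coeff (k := k) (by omega)]
    exact .mul (hB₃ (hP ⟨i, rfl⟩)) (hQ ⟨i, rfl⟩)
  -- The inverse of `w` is the power `w ^ (2 ^ k - 1)`, so its powers are already available.
  refine (Computes.fourier k (w := w ^ (2 ^ k - 1)) (a := fun i => (p' * q').eval (w ^ i))
    (by rw [← pow_mul, mul_comm, pow_mul, hw.1, one_pow]) (fun j hj => hPQ ⟨j, hj, rfl⟩)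
    fun i => hB₄ (hB₃ (hB₂ (by rw [← pow_mul]; exact hpow' _)))).bind
    (c' := 2 ^ k) le_rfl fun B₅ _ hR => ?_
  refine ((Computes.of_isOp_lt (f := (p * q).coeff) n fun e he => ?_).weaken (by omega))
  rw [coeff_eq_of_X_pow_dvd_sub hdvd he]
  have h2 : (p' * q').coeff e = dft k (fun i => (p' * q').eval (w ^ i)) (w ^ (2 ^ k - 1)) e *
      Ring.inverse ((2 ^ k : ℕ) : R) := by
    rw [hw.dft_eval hpq (by omega), mul_assoc]
    have h3 := Ring.mul_inverse_cancel _ hw.2.1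
    rw [show (2 : R) ^ k = ((2 ^ k : ℕ) : R) by push_cast; rfl, h3, mul_one]
  rw [h2]
  exact .divNat (hR ⟨e, rfl⟩) hw.2.1

/-- Multiplication modulo `X ^ n` in `O(n log n)` operations. -/
theorem Computes.mul {B : Set R} {ω : ℕ → R} (hω : IsFFTFamily ω) (h0 : (0 : R) ∈ B)
    (h1 : (1 : R) ∈ B) (hB : Set.range ω ⊆ B) {n N : ℕ} (hn : 0 < n) (hN : n ≤ N)
    {p q : R[X]} (hp : coeffsLT p n ⊆ B) (hq : coeffsLT q n ⊆ B) :
    Computes B (36 * Nat.clog 2 (2 * N) * n) (coeffsLT (p * q) n) := by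
  refine (Computes.mul_of_le hω h0 h1 hB hn (Nat.le_pow_clog one_lt_two (2 * n)) hp hq).weaken ?_
  -- Taking the logarithm at the upper bound `N` gives all Newton steps the same factor. Minimality
  -- of the transform length gives `2 ^ k < 4 * n`, whence `36 = 9 * 4`.
  have h2 : Nat.clog 2 (2 * n) ≤ Nat.clog 2 (2 * N) := Nat.clog_mono_right 2 (by omega)
  have h3 := Nat.pow_pred_clog_lt_self one_lt_two (show 1 < 2 * n by omega)
  have h4 : 0 < Nat.clog 2 (2 * n) := Nat.clog_pos one_lt_two (by omega)
  generalize Nat.clog 2 (2 * n) = k at *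
  obtain ⟨k, rfl⟩ := Nat.exists_eq_add_of_le' h4
  rw [Nat.pred_eq_sub_one, Nat.add_sub_cancel] at h3
  calc 6 * (k + 1) * 2 ^ (k + 1) + 3 * 2 ^ (k + 1) ≤ 9 * (k + 1) * 2 ^ (k + 1) := by
        have : 1 * 2 ^ (k + 1) ≤ (k + 1) * 2 ^ (k + 1) := Nat.mul_le_mul_right _ (by omega)
        linarith
    _ ≤ 9 * (k + 1) * (4 * n) := Nat.mul_le_mul_left _ (by rw [pow_succ]; omega)
    _ = 36 * (k + 1) * n := by ring
    _ ≤ _ := Nat.mul_le_mul_right _ (Nat.mul_le_mul_left _ h2)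

end Multiplication

/-! ### Regular series, the derivation `s d/ds` and Kronecker substitution -/

section Kronecker

open Polynomial

variable {R : Type v} [CommRing R] {r : ℕ}

/-- The derivation `s * d/ds`. -/
noncomputable def theta (r : ℕ) (R : Type v) [CommRing R] :
    Derivation (MvPolynomial (Fin r) R) (MvPolynomial (Fin r) R)[X]
      (MvPolynomial (Fin r) R)[X] :=
  (X : (MvPolynomial (Fin r) R)[X]) • derivative'

theorem theta_apply (x : (MvPolynomial (Fin r) R)[X]) : theta r R x = X * derivative x := rfl

theorem coeff_theta (x : (MvPolynomial (Fin r) R)[X]) (n : ℕ) :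
    (theta r R x).coeff n = n * x.coeff n := by
  rw [theta_apply]
  cases n with
  | zero => simp
  | succ n => rw [coeff_X_mul, coeff_derivative, mul_comm]; push_cast; rfl

theorem theta_mul (x y : (MvPolynomial (Fin r) R)[X]) :
    theta r R (x * y) = theta r R x * y + x * theta r R y := by
  rw [Derivation.leibniz, smul_eq_mul, smul_eq_mul]
  ring

theorem theta_algebraMap_mul (a : R) (x : (MvPolynomial (Fin r) R)[X]) :
    theta r R (algebraMap R _ a * x) = algebraMap R _ a * theta r R x := by
  have : theta r R (algebraMap R _ a) = 0 := (theta r R).map_algebraMap (MvPolynomial.C a)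
  rw [theta_mul, this, zero_mul, zero_add]

theorem X_pow_dvd_theta {m : ℕ} {x : (MvPolynomial (Fin r) R)[X]} (h : X ^ m ∣ x) :
    X ^ m ∣ theta r R x := by
  rw [X_pow_dvd_iff] at h ⊢
  intro e he
  rw [coeff_theta, h e he, mul_zero]

theorem X_pow_dvd_of_theta {d m : ℕ} (hu : ∀ n, 0 < n → n < d → IsUnit (n : R)) (hm : m ≤ d)
    {x : (MvPolynomial (Fin r) R)[X]} (h0 : x.coeff 0 = 0) (h : X ^ m ∣ theta r R x) :
    X ^ m ∣ x := by
  rw [X_pow_dvd_iff] at h ⊢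
  intro e he
  rcases Nat.eq_zero_or_pos e with rfl | h1
  · exact h0
  · have h2 := h e he
    rw [coeff_theta] at h2
    have h3 : IsUnit ((e : ℕ) : MvPolynomial (Fin r) R) := by
      simpa using (hu e h1 (by omega)).map (MvPolynomial.C (σ := Fin r))
    exact h3.mul_right_eq_zero.1 h2

/-- The series which are regular in `y`. -/
noncomputable def regular (r : ℕ) (R : Type v) [CommRing R] :
    Subalgebra R (MvPolynomial (Fin r) R)[X] where
  carrier := {x | ∀ n, (x.coeff n).totalDegree ≤ n}
  add_mem' hx hy n := by
    rw [coeff_add]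
    exact (MvPolynomial.totalDegree_add _ _).trans (max_le (hx n) (hy n))
  mul_mem' {x y} hx hy n := by
    rw [coeff_mul]
    refine MvPolynomial.totalDegree_finsetSum_le fun i hi => ?_
    rw [← Finset.HasAntidiagonal.mem_antidiagonal.1 hi]
    exact (MvPolynomial.totalDegree_mul _ _).trans (add_le_add (hx _) (hy _))
  algebraMap_mem' a n := by
    rw [show algebraMap R (MvPolynomial (Fin r) R)[X] a = C (MvPolynomial.C a) from rfl, coeff_C]
    split_ifs <;> simp

theorem monomial_mem_regular {n : ℕ} {α : Fin r →₀ ℕ} (h : α.degree ≤ n) (a : R) :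
    monomial n (MvPolynomial.monomial α a) ∈ regular r R := by
  intro k
  rw [coeff_monomial]
  split_ifs with hk
  · exact ((MvPolynomial.totalDegree_monomial_le α a).trans h).trans hk.le
  · simp

theorem truncLT_mem_regular {x : (MvPolynomial (Fin r) R)[X]} (hx : x ∈ regular r R) (m : ℕ) :
    truncLT m x ∈ regular r R := by
  intro n
  rw [coeff_truncLT]
  split_ifs
  exacts [hx n, by simp]

theorem degree_le_of_mem_regular {x : (MvPolynomial (Fin r) R)[X]} (hx : x ∈ regular r R) {n : ℕ}
    {α : Fin r →₀ ℕ} (h : α ∈ (x.coeff n).support) : α.degree ≤ n :=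
  (MvPolynomial.le_totalDegree h).trans (hx n)

/-- The condition `x.coeff n ≠ 0` keeps track of which powers of `s` occur; this is what bounds the
exponents of a truncated series. -/
theorem regular_induction {P : (MvPolynomial (Fin r) R)[X] → Prop}
    {x : (MvPolynomial (Fin r) R)[X]} (hx : x ∈ regular r R) (h0 : P 0)
    (hadd : ∀ y z, P y → P z → P (y + z))
    (hmon : ∀ n (α : Fin r →₀ ℕ) a, x.coeff n ≠ 0 → α.degree ≤ n →
      P (monomial n (MvPolynomial.monomial α a))) : P x := by
  rw [as_sum_support x]
  refine Finset.sum_induction _ P hadd h0 fun n hn => ?_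
  rw [← MvPolynomial.support_sum_monomial_coeff (x.coeff n), map_sum]
  exact Finset.sum_induction _ P hadd h0 fun α hα =>
    hmon n α _ (mem_support_iff.1 hn) (degree_le_of_mem_regular hx hα)

/-- The exponent which encodes the monomial `y ^ α * s ^ n`. -/
def code (d n : ℕ) (α : Fin r →₀ ℕ) : ℕ := n * d ^ r + ∑ i, α i * d ^ (i : ℕ)

theorem apply_lt_of_degree_lt {d : ℕ} {α : Fin r →₀ ℕ} (h : α.degree < d) (i : Fin r) :
    α i < d := (Finsupp.le_degree i α).trans_lt h

theorem sum_digits_lt {d : ℕ} {α : Fin r →₀ ℕ} (h : α.degree < d) :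
    ∑ i, α i * d ^ (i : ℕ) < d ^ r := by
  have := (finFunctionFinEquiv fun i => (⟨α i, apply_lt_of_degree_lt h i⟩ : Fin d)).isLt
  rwa [finFunctionFinEquiv_apply] at this

theorem sum_digits_injective {d : ℕ} {α β : Fin r →₀ ℕ} (hα : α.degree < d) (hβ : β.degree < d)
    (h : ∑ i, α i * d ^ (i : ℕ) = ∑ i, β i * d ^ (i : ℕ)) : α = β := by
  have h1 : (fun i => (⟨α i, apply_lt_of_degree_lt hα i⟩ : Fin d)) =
      fun i => ⟨β i, apply_lt_of_degree_lt hβ i⟩ := by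
    apply finFunctionFinEquiv.injective
    apply Fin.ext
    rw [finFunctionFinEquiv_apply, finFunctionFinEquiv_apply]
    exact h
  ext i
  exact congrArg Fin.val (congrFun h1 i)

theorem code_div {d : ℕ} (n : ℕ) {α : Fin r →₀ ℕ} (h : α.degree < d) :
    code d n α / d ^ r = n := by
  have hd : 0 < d ^ r := pow_pos (by omega) _
  rw [code, mul_comm, Nat.mul_add_div hd, Nat.div_eq_of_lt (sum_digits_lt h), add_zero]

theorem mul_le_code (d n : ℕ) (α : Fin r →₀ ℕ) : n * d ^ r ≤ code d n α := Nat.le_add_right _ _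

theorem code_lt {d n m : ℕ} {α : Fin r →₀ ℕ} (h : α.degree < d) (hn : n < m) :
    code d n α < m * d ^ r := by
  have hd : 0 < d ^ r := pow_pos (by omega) _
  rwa [← Nat.div_lt_iff_lt_mul hd, code_div n h]

/-- The bound `n' * d ^ r ≤ code d n' α' < (n + 1) * d ^ r` forces `n' ≤ n < d`, after which
base-`d` digits are unique. Bounding only `n` in advance allows comparison with series of arbitrary
degree in `s`. -/
theorem code_injective {d n n' : ℕ} {α α' : Fin r →₀ ℕ} (hn : n < d) (hα : α.degree ≤ n)
    (hα' : α'.degree ≤ n') (h : code d n α = code d n' α') : n = n' ∧ α = α' := by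
  have h1 : n' * d ^ r < (n + 1) * d ^ r :=
    ((mul_le_code d n' α').trans h.ge).trans_lt (code_lt (by omega) (by omega))
  have h2 : n' < n + 1 := Nat.lt_of_mul_lt_mul_right h1
  have h3 : n = n' := by
    rw [← code_div (d := d) n (α := α) (by omega), h, code_div n' (by omega)]
  subst h3
  exact ⟨rfl, sum_digits_injective (d := d) (by omega) (by omega) (Nat.add_left_cancel h)⟩

/-- Kronecker substitution. -/
noncomputable def kron (d r : ℕ) (R : Type v) [CommRing R] :
    (MvPolynomial (Fin r) R)[X] →+* R[X] :=
  eval₂RingHom (MvPolynomial.eval₂Hom C fun i => X ^ d ^ (i : ℕ)) (X ^ d ^ r)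

theorem kron_monomial (d n : ℕ) (α : Fin r →₀ ℕ) (a : R) :
    kron d r R (monomial n (MvPolynomial.monomial α a)) = monomial (code d n α) a := by
  rw [kron, coe_eval₂RingHom, eval₂_monomial, MvPolynomial.eval₂Hom_monomial,
    Finsupp.prod_fintype _ _ (by simp), ← C_mul_X_pow_eq_monomial, code, mul_assoc]
  simp_rw [← pow_mul]
  rw [Finset.prod_pow_eq_pow_sum, ← pow_add, add_comm]
  simp_rw [mul_comm]

theorem coeff_kron_of_X_pow_dvd {d m : ℕ} {x : (MvPolynomial (Fin r) R)[X]} (h : X ^ m ∣ x) {e : ℕ}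
    (he : e < m * d ^ r) : (kron d r R x).coeff e = 0 := by
  obtain ⟨y, rfl⟩ := h
  rw [map_mul, map_pow, show kron d r R X = X ^ d ^ r from eval₂_X _ _, ← pow_mul, mul_comm (d ^ r),
    coeff_X_pow_mul', if_neg (by omega)]

theorem coeff_kron_congr {d m : ℕ} {x y : (MvPolynomial (Fin r) R)[X]} (h : X ^ m ∣ x - y) {e : ℕ}
    (he : e < m * d ^ r) : (kron d r R x).coeff e = (kron d r R y).coeff e := by
  rw [← sub_eq_zero, ← coeff_sub, ← map_sub]
  exact coeff_kron_of_X_pow_dvd h he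

theorem coeff_kron_code {d n : ℕ} {α : Fin r →₀ ℕ} (hn : n < d) (hα : α.degree ≤ n)
    {x : (MvPolynomial (Fin r) R)[X]} (hx : x ∈ regular r R) :
    (kron d r R x).coeff (code d n α) = MvPolynomial.coeff α (x.coeff n) := by
  refine regular_induction (P := fun x => (kron d r R x).coeff (code d n α) =
    MvPolynomial.coeff α (x.coeff n)) hx (by simp) (fun y z hy hz => by simp [hy, hz]) fun n' α' a _ h => ?_
  rw [kron_monomial, coeff_monomial, coeff_monomial]
  by_cases hc : code d n' α' = code d n α
  · obtain ⟨rfl, rfl⟩ := code_injective hn hα h hc.symm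
    simp
  · rw [if_neg hc]
    split_ifs with hnn
    · subst hnn
      rw [MvPolynomial.coeff_monomial, if_neg]
      rintro rfl
      exact hc rfl
    · simp

/-- A monomial encoded at `e < d * d ^ r` has `n < d`, so its `y` part contributes less than `d ^ r`
and its `s`-degree is the quotient `e / d ^ r`. -/
theorem coeff_kron_theta {d e : ℕ} (he : e < d * d ^ r) {x : (MvPolynomial (Fin r) R)[X]}
    (hx : x ∈ regular r R) :
    (kron d r R (theta r R x)).coeff e = (e / d ^ r : ℕ) * (kron d r R x).coeff e := by
  refine regular_induction (P := fun x => (kron d r R (theta r R x)).coeff e =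
    (e / d ^ r : ℕ) * (kron d r R x).coeff e) hx (by simp)
    (fun y z hy hz => by simp only [map_add, coeff_add, hy, hz, mul_add])
    fun n α a _ h => ?_
  have h1 : theta r R (monomial n (MvPolynomial.monomial α a)) =
      monomial n (MvPolynomial.monomial α ((n : R) * a)) := by
    ext1 k
    rw [coeff_theta, coeff_monomial, coeff_monomial]
    split_ifs with hk
    · subst hk
      rw [← map_natCast (MvPolynomial.C (σ := Fin r) (R := R)), MvPolynomial.C_mul_monomial]
    · simp
  rw [h1, kron_monomial, kron_monomial, coeff_monomial, coeff_monomial]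
  split_ifs with hc
  · subst hc
    have hn : n < d := Nat.lt_of_mul_lt_mul_right ((mul_le_code d n α).trans_lt he)
    rw [code_div n (by omega)]
  · simp

theorem coeff_kron_truncLT {d m e : ℕ} (hm : m ≤ d) (he : m * d ^ r ≤ e)
    {x : (MvPolynomial (Fin r) R)[X]} (hx : x ∈ regular r R) :
    (kron d r R (truncLT m x)).coeff e = 0 := by
  refine regular_induction (P := fun x => (kron d r R x).coeff e = 0)
    (truncLT_mem_regular hx m) (by simp)
    (fun y z hy hz => by simp [hy, hz]) fun n α a hn h => ?_
  rw [coeff_truncLT] at hn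
  have hn' : n < m := by
    by_contra h'
    exact hn (if_neg h')
  rw [kron_monomial, coeff_monomial, if_neg]
  have := code_lt (d := d) (α := α) (by omega) hn'
  omega

end Kronecker

/-! ### Differential equation of the exponential, and the Newton congruences -/

section Exponential

open Polynomial

variable {R : Type v} [CommRing R] {r : ℕ}

/-- The sum of `p ^ n / n!` over `n < d`. -/
noncomputable def expTrunc (d : ℕ) (p : (MvPolynomial (Fin r) R)[X]) : (MvPolynomial (Fin r) R)[X] :=
  ∑ n ∈ Finset.range d, algebraMap R _ (Ring.inverse (n.factorial : R)) * p ^ n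

theorem expTrunc_mem_regular {p : (MvPolynomial (Fin r) R)[X]} (hp : p ∈ regular r R) (d : ℕ) :
    expTrunc d p ∈ regular r R :=
  sum_mem fun n _ => mul_mem ((regular r R).algebraMap_mem _) (pow_mem hp n)

theorem isUnit_factorial {d : ℕ} (hu : ∀ n, 0 < n → n < d → IsUnit (n : R)) {n : ℕ} (hn : n < d) :
    IsUnit (n.factorial : R) := by
  induction n with
  | zero => simp
  | succ n ih =>
    rw [Nat.factorial_succ, Nat.cast_mul]
    exact (hu _ n.succ_pos hn).mul (ih (by omega))

theorem theta_expTrunc_succ {d : ℕ} (hu : ∀ n, 0 < n → n < d → IsUnit (n : R))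
    (p : (MvPolynomial (Fin r) R)[X]) {n : ℕ} (hn : n < d) :
    theta r R (expTrunc (n + 1) p) = theta r R p * expTrunc n p := by
  induction n with
  | zero =>
    rw [expTrunc, Finset.sum_range_one, theta_algebraMap_mul]
    simp [expTrunc]
  | succ n ih =>
    have h1 : algebraMap R (MvPolynomial (Fin r) R)[X] (Ring.inverse ((n + 1).factorial : R)) *
        ((n + 1 : ℕ) : (MvPolynomial (Fin r) R)[X]) =
        algebraMap R (MvPolynomial (Fin r) R)[X] (Ring.inverse (n.factorial : R)) := by
      rw [← map_natCast (algebraMap R (MvPolynomial (Fin r) R)[X]), ← map_mul]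
      congr 1
      rw [Nat.factorial_succ, Nat.cast_mul,
        Ring.mul_inverse_rev, mul_assoc, Ring.inverse_mul_cancel _ (hu _ n.succ_pos hn), mul_one]
    rw [expTrunc, Finset.sum_range_succ, ← expTrunc, map_add, ih (by omega), theta_algebraMap_mul,
      Derivation.leibniz_pow, expTrunc, expTrunc, Finset.sum_range_succ, ← h1]
    simp only [smul_eq_mul, nsmul_eq_mul, Nat.add_sub_cancel]
    ring

/-- The difference is `θp * p ^ (d - 1) / (d - 1)!` up to sign, and both `θp` and `p` are divisible
by `s`. -/
theorem dvd_theta_expTrunc {d : ℕ} (hu : ∀ n, 0 < n → n < d → IsUnit (n : R))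
    {p : (MvPolynomial (Fin r) R)[X]} (hp : X ∣ p) :
    X ^ d ∣ theta r R (expTrunc d p) - theta r R p * expTrunc d p := by
  cases d with
  | zero => simp
  | succ d =>
    rw [theta_expTrunc_succ hu p d.lt_succ_self, expTrunc, expTrunc, Finset.sum_range_succ,
      ← mul_sub, pow_succ']
    have h1 : X ∣ theta r R p := by
      simpa using X_pow_dvd_theta (m := 1) (by simpa using hp)
    refine mul_dvd_mul h1 ?_
    rw [sub_add_cancel_left]
    exact ((pow_dvd_pow_of_dvd hp d).mul_left _).neg_right

theorem X_dvd_expTrunc_sub_one {d : ℕ} (hd : 0 < d) {p : (MvPolynomial (Fin r) R)[X]}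
    (hp : X ∣ p) : X ∣ expTrunc d p - 1 := by
  obtain ⟨d, rfl⟩ := Nat.exists_eq_add_of_le' hd
  rw [expTrunc, Finset.sum_range_succ']
  simp only [Nat.factorial_zero, Nat.cast_one, Ring.inverse_one, map_one, pow_zero, mul_one,
    add_sub_cancel_right]
  exact Finset.dvd_sum fun n _ => (hp.trans (dvd_pow_self p n.succ_ne_zero)).mul_left _

/-- By the Leibniz rule the logarithmic derivatives `θp` and `-θp` cancel, so `θ` kills the product
modulo `s ^ d`; its constant term is `1`. -/
theorem dvd_expTrunc_mul_expTrunc_neg {d : ℕ} (hd : 0 < d)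
    (hu : ∀ n, 0 < n → n < d → IsUnit (n : R))
    {p : (MvPolynomial (Fin r) R)[X]} (hp : X ∣ p) :
    X ^ d ∣ expTrunc d p * expTrunc d (-p) - 1 := by
  have h1 := dvd_theta_expTrunc hu hp
  have h2 := dvd_theta_expTrunc hu (dvd_neg.2 hp)
  refine X_pow_dvd_of_theta hu le_rfl ?_ ?_
  · have h3 := dvd_mul_sub_mul (X_dvd_expTrunc_sub_one hd hp)
      (X_dvd_expTrunc_sub_one hd (dvd_neg.2 hp))
    rw [mul_one] at h3
    exact X_dvd_iff.1 h3
  · rw [map_sub, theta_mul, Derivation.map_one_eq_zero]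
    rw [map_neg] at h2
    have := dvd_add (h1.mul_right (expTrunc d (-p))) (h2.mul_left (expTrunc d p))
    convert this using 1
    ring

/-- Expresses `θ((F - E) * F')` through the known `E`, `G` and `θp`. Modulo `t` it equals `F' * ((θF
- θE) - θp * (F - E))`; the bracket is divisible by `s`, so `F'` may be replaced by `G`, and then
`θF` cancels `θp * F`. -/
theorem newton_derivative {A : Type*} [CommRing A] {s t F F' E G θF θF' θE θp : A} (hs : s ∣ F - E)
    (hθ : s ∣ θF - θE) (hG : s ∣ F' - G) (hF : t ∣ θF - θp * F) (hF' : t ∣ θF' + θp * F')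
    (ht : t ∣ s * s) :
    t ∣ G * (θp * E - θE) - ((θF - θE) * F' + (F - E) * θF') := by
  have h1 : t ∣ (F' - G) * ((θF - θE) - θp * (F - E)) :=
    ht.trans (mul_dvd_mul hG (dvd_sub hθ (hs.mul_left θp)))
  have h2 := (h1.add (hF.mul_left G)).add (hF'.mul_left (F - E))
  rw [← dvd_neg]
  convert h2 using 1
  ring

/-- Modulo `F * F' = 1` the error is `(F - E) ^ 2 * F'`. -/
theorem newton_exp {A : Type*} [CommRing A] {s t F F' E : A} (hs : s ∣ F - E)
    (hF : t ∣ F * F' - 1) (ht : t ∣ s * s) : t ∣ F - (E + E * ((F - E) * F')) := by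
  have h1 := ((ht.trans (mul_dvd_mul hs hs)).mul_right F').sub (hF.mul_left (F - E))
  convert h1 using 1
  ring

/-- Modulo `F * F' = 1` the error is `(F' - G) * (1 - F * G)`, and both factors are divisible by
`s`. -/
theorem newton_inv {A : Type*} [CommRing A] {s t F F' G : A} (hG : s ∣ F' - G)
    (hF : t ∣ F * F' - 1) (hst : s ∣ t) (ht : t ∣ s * s) : t ∣ F' - (G + G * (1 - F * G)) := by
  have h1 : s ∣ 1 - F * G := by
    convert (hG.mul_left F).sub (hst.trans hF) using 1
    ring
  have h2 := (ht.trans (mul_dvd_mul hG h1)).add (hF.mul_right G)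
  convert h2 using 1
  ring

end Exponential

/-! ### Newton iteration on encoded series and its cost -/

section Newton

open Polynomial

variable {R : Type v} [CommRing R] {r d : ℕ}

/-- A regular series truncated at `s ^ m` has no encoded exponent from `m * d ^ r` on, so the known
coefficients need only be padded with zeros. -/
theorem coeffsLT_kron_truncLT_subset {m : ℕ} (hm : m ≤ d) {x : (MvPolynomial (Fin r) R)[X]}
    (hx : x ∈ regular r R) {B : Set R} (h0 : (0 : R) ∈ B)
    (hB : coeffsLT (kron d r R x) (m * d ^ r) ⊆ B) (n : ℕ) :
    coeffsLT (kron d r R (truncLT m x)) n ⊆ B := by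
  rw [coeffsLT_subset] at hB ⊢
  intro e _
  rcases Nat.lt_or_ge e (m * d ^ r) with he | he
  · rw [← coeff_kron_congr (X_pow_dvd_sub_truncLT m x) he]
    exact hB e he
  · rw [coeff_kron_truncLT hm he hx]
    exact h0

theorem coeff_one_mem {B : Set R} (h0 : (0 : R) ∈ B) (h1 : (1 : R) ∈ B) (e : ℕ) :
    (1 : R[X]).coeff e ∈ B := by
  rw [coeff_one]
  split_ifs
  exacts [h1, h0]

/-- The constant `186` is `5 * 36 + 6`: five products and six coefficientwise passes. -/
theorem Computes.newton {B : Set R} {ω : ℕ → R} (hω : IsFFTFamily ω) (hd : 1 < d)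
    (hu : ∀ n, 0 < n → n < d → IsUnit (n : R)) (hc : ∀ n < d, (n : R) ∈ B)
    (hωB : Set.range ω ⊆ B) {p : (MvPolynomial (Fin r) R)[X]} (hp : p ∈ regular r R)
    (hXp : X ∣ p) {m m' : ℕ} (hm : 0 < m) (hmm : m ≤ m') (hm2 : m' ≤ 2 * m) (hmd : m' ≤ d)
    (hθ : coeffsLT (kron d r R (theta r R p)) (d * d ^ r) ⊆ B)
    (hF : coeffsLT (kron d r R (expTrunc d p)) (m * d ^ r) ⊆ B)
    (hF' : coeffsLT (kron d r R (expTrunc d (-p))) (m * d ^ r) ⊆ B) :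
    Computes B (186 * Nat.clog 2 (2 * (d * d ^ r)) * (m' * d ^ r))
      (coeffsLT (kron d r R (expTrunc d p)) (m' * d ^ r) ∪
        coeffsLT (kron d r R (expTrunc d (-p))) (m' * d ^ r)) := by
  have h0 : (0 : R) ∈ B := by simpa using hc 0 (by omega)
  have h1 : (1 : R) ∈ B := by simpa using hc 1 hd
  have hFr := expTrunc_mem_regular hp d
  have hFr' := expTrunc_mem_regular (neg_mem hp) d
  have hθF := dvd_theta_expTrunc hu hXp
  have hθF' : X ^ d ∣ theta r R (expTrunc d (-p)) + theta r R p * expTrunc d (-p) := by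
    have h := dvd_theta_expTrunc hu (p := -p) hXp.neg_right
    rw [map_neg] at h
    convert h using 1
    ring
  have hFF := dvd_expTrunc_mul_expTrunc_neg (by omega) hu hXp
  generalize expTrunc d p = F at *
  generalize expTrunc d (-p) = F' at *
  have hK : 0 < d ^ r := pow_pos (by omega) _
  have hnN : m' * d ^ r ≤ d * d ^ r := Nat.mul_le_mul_right _ hmd
  have hn0 : 0 < m' * d ^ r := Nat.mul_pos (by omega) hK
  have hdvd : (X : (MvPolynomial (Fin r) R)[X]) ^ m' ∣ X ^ d := pow_dvd_pow _ hmd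
  have hsq : (X : (MvPolynomial (Fin r) R)[X]) ^ m' ∣ X ^ m * X ^ m := by
    rw [← pow_add]
    exact pow_dvd_pow _ (by omega)
  have hE := coeffsLT_kron_truncLT_subset (by omega) hFr h0 hF (m' * d ^ r)
  have hG := coeffsLT_kron_truncLT_subset (by omega) hFr' h0 hF' (m' * d ^ r)
  have hEF := X_pow_dvd_sub_truncLT m F
  have hGF := X_pow_dvd_sub_truncLT m F'
  have hEr := truncLT_mem_regular hFr m
  generalize truncLT m F = E at *
  generalize truncLT m F' = G at *
  have hur : (F - E) * F' ∈ regular r R := mul_mem (sub_mem hFr hEr) hFr'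
  have hu0 : X ^ 1 ∣ (F - E) * F' := by
    exact ((pow_dvd_pow _ hm).trans hEF).mul_right _
  have hDu : X ^ m' ∣ G * (theta r R p * E - theta r R E) - theta r R ((F - E) * F') := by
    rw [theta_mul, map_sub]
    exact newton_derivative hEF (by rw [← map_sub]; exact X_pow_dvd_theta hEF) hGF
      (hdvd.trans hθF) (hdvd.trans hθF') hsq
  have hFnew := newton_exp hEF (hdvd.trans hFF) hsq
  have hFnew' := newton_inv hGF (hdvd.trans hFF) (pow_dvd_pow _ hmm) hsq
  generalize (F - E) * F' = u at *
  have hκ : 0 < Nat.clog 2 (2 * (d * d ^ r)) := Nat.clog_pos one_lt_two (by omega)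
  have hmul : ∀ {B' : Set R} {a b : (MvPolynomial (Fin r) R)[X]}, B ⊆ B' →
      coeffsLT (kron d r R a) (m' * d ^ r) ⊆ B' → coeffsLT (kron d r R b) (m' * d ^ r) ⊆ B' →
      Computes B' (36 * Nat.clog 2 (2 * (d * d ^ r)) * (m' * d ^ r))
        (coeffsLT (kron d r R (a * b)) (m' * d ^ r)) := fun hB ha hb => by
    rw [map_mul]
    exact Computes.mul hω (hB h0) (hB h1) (hωB.trans hB) hn0 hnN ha hb
  generalize Nat.clog 2 (2 * (d * d ^ r)) = κ at *
  have hθ' : coeffsLT (kron d r R (theta r R p)) (m' * d ^ r) ⊆ B :=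
    (Set.image_mono (Set.Iio_subset_Iio hnN)).trans hθ
  obtain ⟨n, hn⟩ : ∃ n, n = m' * d ^ r := ⟨_, rfl⟩
  have hcost : n ≤ κ * n := Nat.le_mul_of_pos_left n hκ
  have hdiv : ∀ e < n, e / d ^ r < d := fun e he => by
    rw [Nat.div_lt_iff_lt_mul hK]
    omega
  rw [← hn] at hmul hθ' hE hG hnN hn0 ⊢
  refine (hmul subset_rfl hθ' hE).bind (c' := 144 * κ * n + 6 * n) (by nlinarith)
    fun B₁ hB₁ h₁ => ?_
  refine (of_isOp_lt (B := B₁) (f := (kron d r R (theta r R E)).coeff) n fun e he => ?_).bind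
    (c' := 144 * κ * n + 5 * n) (by omega) fun B₂ hB₂ h₂ => ?_
  · rw [coeff_kron_theta (by omega) hEr]
    exact .mul (hB₁ (hc _ (hdiv e he))) (hB₁ (hE ⟨e, he, rfl⟩))
  have h₁₂ := hB₂
  replace hB₂ := hB₁.trans hB₂
  refine (of_isOp_lt (B := B₂)
    (f := (kron d r R (theta r R p * E - theta r R E)).coeff) n fun e he => ?_).bind
    (c' := 144 * κ * n + 4 * n) (by omega) fun B₃ hB₃ h₃ => ?_
  · rw [map_sub, coeff_sub]
    exact .sub (h₁₂ (h₁ ⟨e, he, rfl⟩)) (h₂ ⟨e, he, rfl⟩)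
  replace hB₃ := hB₂.trans hB₃
  refine (hmul hB₃ (hG.trans hB₃) h₃).bind (c' := 108 * κ * n + 4 * n) (by nlinarith)
    fun B₄ hB₄ h₄ => ?_
  replace hB₄ := hB₃.trans hB₄
  refine (of_isOp_lt (B := B₄) (f := (kron d r R u).coeff) n fun e he => ?_).bind
    (c' := 108 * κ * n + 3 * n) (by omega) fun B₅ hB₅ h₅ => ?_
  -- Integration cannot divide by `0`, but `u` is divisible by `s`, so these coefficients vanish.
  · rcases Nat.eq_zero_or_pos (e / d ^ r) with hz | hz
    · rw [coeff_kron_of_X_pow_dvd hu0 (by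
        rw [one_mul]
        exact (Nat.div_eq_zero_iff_lt hK).1 hz), ← add_zero (0 : R)]
      exact .add (hB₄ h0) (hB₄ h0)
    · have hunit := hu _ hz (hdiv e he)
      have h6 : (kron d r R u).coeff e = (kron d r R (G * (theta r R p * E - theta r R E))).coeff e *
          Ring.inverse ((e / d ^ r : ℕ) : R) := by
        rw [coeff_kron_congr hDu (hn ▸ he), coeff_kron_theta (by omega) hur, mul_comm, ← mul_assoc,
          Ring.inverse_mul_cancel _ hunit, one_mul]
      rw [h6]
      exact .divNat (h₄ ⟨e, he, rfl⟩) hunit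
  replace hB₅ := hB₄.trans hB₅
  refine (hmul hB₅ (hE.trans hB₅) h₅).bind (c' := 72 * κ * n + 3 * n) (by nlinarith)
    fun B₆ hB₆ h₆ => ?_
  replace hB₆ := hB₅.trans hB₆
  refine (of_isOp_lt (B := B₆) (f := (kron d r R F).coeff) n fun e he => ?_).bind
    (c' := 72 * κ * n + 2 * n) (by omega) fun B₇ hB₇ h₇ => ?_
  · rw [coeff_kron_congr hFnew (hn ▸ he), map_add, coeff_add]
    exact .add (hB₆ (hE ⟨e, he, rfl⟩)) (h₆ ⟨e, he, rfl⟩)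
  replace hB₇ := hB₆.trans hB₇
  refine (hmul hB₇ h₇ (hG.trans hB₇)).bind (c' := 36 * κ * n + 2 * n) (by nlinarith)
    fun B₈ hB₈ h₈ => ?_
  have h₇₈ := hB₈
  replace hB₈ := hB₇.trans hB₈
  refine (of_isOp_lt (B := B₈) (f := (kron d r R (1 - F * G)).coeff) n fun e he => ?_).bind
    (c' := 36 * κ * n + n) (by omega) fun B₉ hB₉ h₉ => ?_
  · rw [map_sub, map_one, coeff_sub]
    exact .sub (coeff_one_mem (hB₈ h0) (hB₈ h1) e) (h₈ ⟨e, he, rfl⟩)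
  have h₇₉ := h₇₈.trans hB₉
  replace hB₉ := hB₈.trans hB₉
  refine (hmul hB₉ (hG.trans hB₉) h₉).bind (c' := n) (by nlinarith) fun B₁₀ hB₁₀ h₁₀ => ?_
  refine (of_isOp_lt (B := B₁₀) (f := (kron d r R F').coeff) n fun e he => ?_).bind
    (c' := 0) le_rfl fun B₁₁ hB₁₁ h₁₁ => .done (Set.union_subset ?_ h₁₁)
  · rw [coeff_kron_congr hFnew' (hn ▸ he), map_add, coeff_add]
    exact .add (hB₁₀ (hB₉ (hG ⟨e, he, rfl⟩))) (h₁₀ ⟨e, he, rfl⟩)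
  · exact h₇.trans (h₇₉.trans (hB₁₀.trans hB₁₁))

theorem coeffsLT_kron_expTrunc_one_subset (hd : 0 < d) {p : (MvPolynomial (Fin r) R)[X]}
    (hXp : X ∣ p) {B : Set R} (h0 : (0 : R) ∈ B) (h1 : (1 : R) ∈ B) :
    coeffsLT (kron d r R (expTrunc d p)) (1 * d ^ r) ⊆ B := by
  rw [coeffsLT_subset]
  intro e he
  rw [coeff_kron_congr (by simpa using X_dvd_expTrunc_sub_one hd hXp) he, map_one]
  exact coeff_one_mem h0 h1 e

/-- Doubling from precision `1`, where both exponentials are `1`; the geometric sum gives `372 = 2 *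
186`. -/
theorem Computes.exp_two_pow {B : Set R} {ω : ℕ → R} (hω : IsFFTFamily ω) (hd : 1 < d)
    (hu : ∀ n, 0 < n → n < d → IsUnit (n : R)) (hc : ∀ n < d, (n : R) ∈ B)
    (hωB : Set.range ω ⊆ B) {p : (MvPolynomial (Fin r) R)[X]} (hp : p ∈ regular r R)
    (hXp : X ∣ p) (hθ : coeffsLT (kron d r R (theta r R p)) (d * d ^ r) ⊆ B)
    {j : ℕ} (hj : 2 ^ j ≤ d) :
    Computes B (372 * Nat.clog 2 (2 * (d * d ^ r)) * (2 ^ j * d ^ r))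
      (coeffsLT (kron d r R (expTrunc d p)) (2 ^ j * d ^ r) ∪
        coeffsLT (kron d r R (expTrunc d (-p))) (2 ^ j * d ^ r)) := by
  induction j with
  | zero =>
    have h0 : (0 : R) ∈ B := by simpa using hc 0 (by omega)
    have h1 : (1 : R) ∈ B := by simpa using hc 1 hd
    exact .done (Set.union_subset (coeffsLT_kron_expTrunc_one_subset (by omega) hXp h0 h1)
      (coeffsLT_kron_expTrunc_one_subset (by omega) hXp.neg_right h0 h1))
  | succ j ih =>
    have h2 : 2 ^ (j + 1) = 2 * 2 ^ j := pow_succ' 2 j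
    refine (ih (by omega)).bind (c' := 186 * Nat.clog 2 (2 * (d * d ^ r)) * (2 ^ (j + 1) * d ^ r))
      (by rw [h2]; apply le_of_eq; ring) fun B' hB' hT => ?_
    exact Computes.newton hω hd hu (fun n hn => hB' (hc n hn)) (hωB.trans hB') hp hXp
      (by positivity) (by omega) h2.le hj (hθ.trans hB') (Set.subset_union_left.trans hT)
      (Set.subset_union_right.trans hT)

theorem Computes.exp {B : Set R} {ω : ℕ → R} (hω : IsFFTFamily ω) (hd : 1 < d)
    (hu : ∀ n, 0 < n → n < d → IsUnit (n : R)) (h1 : (1 : R) ∈ B)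
    (hωB : Set.range ω ⊆ B) {p : (MvPolynomial (Fin r) R)[X]} (hp : p ∈ regular r R)
    (hXp : X ∣ p) (hpB : coeffsLT (kron d r R p) (d * d ^ r) ⊆ insert 0 B) :
    Computes B (561 * Nat.clog 2 (2 * (d * d ^ r)) * (d * d ^ r))
      (coeffsLT (kron d r R (expTrunc d p)) (d * d ^ r)) := by
  have hK : 0 < d ^ r := pow_pos (by omega) _
  have hN : d ≤ d * d ^ r := Nat.le_mul_of_pos_right d hK
  have hκ : 0 < Nat.clog 2 (2 * (d * d ^ r)) := Nat.clog_pos one_lt_two (by omega)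
  have hcost : d * d ^ r ≤ Nat.clog 2 (2 * (d * d ^ r)) * (d * d ^ r) :=
    Nat.le_mul_of_pos_left _ hκ
  have hj := Nat.pow_log_le_self 2 (show d ≠ 0 by omega)
  have hj' := Nat.lt_pow_succ_log_self one_lt_two d
  rw [pow_succ] at hj'
  -- A last step goes from precision `2 ^ Nat.log 2 d` to exactly `d`, less than twice as much;
  -- hence `558 = 372 + 186`.
  have hnewton := fun {B' : Set R} (hc : ∀ n < d, (n : R) ∈ B') (hωB' : Set.range ω ⊆ B')
    (hθ : coeffsLT (kron d r R (theta r R p)) (d * d ^ r) ⊆ B') =>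
      (Computes.exp_two_pow hω hd hu hc hωB' hp hXp hθ hj).bind
        (c' := 186 * Nat.clog 2 (2 * (d * d ^ r)) * (d * d ^ r))
        (t := 558 * Nat.clog 2 (2 * (d * d ^ r)) * (d * d ^ r))
        (by
          have := Nat.mul_le_mul_left (372 * Nat.clog 2 (2 * (d * d ^ r)))
            (Nat.mul_le_mul_right (d ^ r) hj)
          linarith) fun B'' hB'' hT =>
        Computes.newton hω hd hu (fun n hn => hB'' (hc n hn)) (hωB'.trans hB'') hp hXp
          (pow_pos two_pos _) hj (by omega) le_rfl (hθ.trans hB'')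
          (Set.subset_union_left.trans hT) (Set.subset_union_right.trans hT)
  generalize Nat.clog 2 (2 * (d * d ^ r)) = κ at *
  -- Zero is not an operand and is made as `1 - 1`. With the integers up to `d` and `θp` this adds
  -- `1 + d + d * d ^ r` operations, hence `561`.
  refine (of_isOp_lt (B := B) (f := fun _ => (0 : R)) 1 fun _ _ => by
    rw [← sub_self (1 : R)]
    exact .sub h1 h1).bind (c' := d + d * d ^ r + 558 * κ * (d * d ^ r)) (by linarith)
    fun B₁ hB₁ h₁ => ?_
  have h0 : (0 : R) ∈ B₁ := h₁ ⟨0, Set.mem_Iio.2 zero_lt_one, rfl⟩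
  refine (of_isOp_succ (B := B₁) (f := fun n => (n : R)) d (by simpa using h0)
    fun B' hB' n _ hn => by
      rw [Nat.cast_succ]
      exact .add hn (hB' (hB₁ h1))).bind (c' := d * d ^ r + 558 * κ * (d * d ^ r))
    (by omega) fun B₂ hB₂ h₂ => ?_
  have hc : ∀ n < d, (n : R) ∈ B₂ := fun n hn => h₂ ⟨n, hn.le, rfl⟩
  have hpB₂ := hpB.trans (Set.insert_subset (hB₂ h0) (hB₁.trans hB₂))
  refine (of_isOp_lt (B := B₂) (f := (kron d r R (theta r R p)).coeff) (d * d ^ r)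
    fun e he => ?_).bind (c' := 558 * κ * (d * d ^ r)) le_rfl fun B₃ hB₃ h₃ => ?_
  · rw [coeff_kron_theta he hp]
    exact .mul (hc _ ((Nat.div_lt_iff_lt_mul hK).2 he)) (hpB₂ ⟨e, he, rfl⟩)
  · exact (hnewton (fun n hn => hB₃ (hc n hn)) (hωB.trans (hB₁.trans (hB₂.trans hB₃))) h₃).subset
      Set.subset_union_left

end Newton

/-! ### Coefficient tables as inputs and outputs -/

section Table

open Polynomial

variable {R : Type v} [CommRing R] {r d : ℕ}

theorem degree_lt_of_regMonomial (q : RegMonomial r d) : q.1.2.degree < d :=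
  q.2.trans_lt q.1.1.isLt

theorem regMonomial_code_injective :
    Function.Injective fun q : RegMonomial r d => code d q.1.1 q.1.2 := by
  intro q q' h
  obtain ⟨h1, h2⟩ := code_injective q.1.1.isLt q.2 q'.2 h
  exact Subtype.ext (Prod.ext (Fin.ext h1) h2)

instance : Finite (RegMonomial r d) :=
  Finite.of_injective
    (fun q => (⟨code d q.1.1 q.1.2, code_lt (degree_lt_of_regMonomial q) q.1.1.isLt⟩ :
      Fin (d * d ^ r)))
    fun _ _ h => regMonomial_code_injective (congrArg Fin.val h)

noncomputable instance : Fintype (RegMonomial r d) := Fintype.ofFinite _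

/-- The regular polynomial with a given table of coefficients. -/
noncomputable def tablePoly (x : RegMonomial r d → R) : (MvPolynomial (Fin r) R)[X] :=
  ∑ q, monomial (q.1.1 : ℕ) (MvPolynomial.monomial q.1.2 (x q))

theorem tablePoly_mem_regular (x : RegMonomial r d → R) : tablePoly x ∈ regular r R :=
  sum_mem fun q _ => monomial_mem_regular q.2 _

theorem coeff_kron_tablePoly (x : RegMonomial r d → R) (e : ℕ) :
    (kron d r R (tablePoly x)).coeff e = ∑ q, if code d q.1.1 q.1.2 = e then x q else 0 := by
  simp_rw [tablePoly, map_sum, kron_monomial, finsetSum_coeff, coeff_monomial]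

theorem coeff_kron_tablePoly_code (x : RegMonomial r d → R) (q : RegMonomial r d) :
    (kron d r R (tablePoly x)).coeff (code d q.1.1 q.1.2) = x q := by
  rw [coeff_kron_tablePoly, Finset.sum_eq_single q]
  · simp
  · exact fun q' _ h => if_neg fun h' => h (regMonomial_code_injective h')
  · simp

theorem coeff_tablePoly (x : RegMonomial r d → R) (q : RegMonomial r d) :
    MvPolynomial.coeff q.1.2 ((tablePoly x).coeff q.1.1) = x q := by
  rw [← coeff_kron_code q.1.1.isLt q.2 (tablePoly_mem_regular x), coeff_kron_tablePoly_code]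

theorem coeffsLT_kron_tablePoly_subset (x : RegMonomial r d → R) (n : ℕ) :
    coeffsLT (kron d r R (tablePoly x)) n ⊆ insert 0 (Set.range x) := by
  rw [coeffsLT_subset]
  intro e _
  by_cases h : ∃ q : RegMonomial r d, code d q.1.1 q.1.2 = e
  · obtain ⟨q, rfl⟩ := h
    exact Or.inr ⟨q, (coeff_kron_tablePoly_code x q).symm⟩
  · rw [coeff_kron_tablePoly]
    exact Or.inl (Finset.sum_eq_zero fun q _ => if_neg fun hq => h ⟨q, hq⟩)

theorem X_dvd_tablePoly {x : RegMonomial r d → R}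
    (h : ∀ q : RegMonomial r d, (q.1.1 : ℕ) = 0 → x q = 0) : X ∣ tablePoly x := by
  refine Finset.dvd_sum fun q _ => ?_
  rw [X_dvd_iff, coeff_monomial]
  split_ifs with hq
  · rw [h q hq, map_zero]
  · rfl

theorem exists_program_exp (hd : 1 < d) (hu : ∀ n, 0 < n → n < d → IsUnit (n : R)) {ω : ℕ → R}
    (hω : IsFFTFamily ω) (x : RegMonomial r d → R)
    (hx : ∀ q : RegMonomial r d, (q.1.1 : ℕ) = 0 → x q = 0) :
    ∃ P : Program (RegMonomial r d) (RegMonomial r d),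
      P.cost ≤ 561 * Nat.clog 2 (2 * (d * d ^ r)) * (d * d ^ r) ∧
      (∀ a n, Instr.divNat a n ∈ P.instrs → IsUnit (n : R)) ∧
      ∀ q, P.eval ω x q = MvPolynomial.coeff q.1.2 ((expTrunc d (tablePoly x)).coeff q.1.1) := by
  have hreg := tablePoly_mem_regular x
  refine (Computes.exp (B := insert 1 (Set.range ω ∪ Set.range x)) hω hd hu (Or.inl rfl)
    (fun _ h => Or.inr (Or.inl h)) hreg (X_dvd_tablePoly hx)
    ((coeffsLT_kron_tablePoly_subset x _).trans
      (Set.insert_subset_insert fun _ h => Or.inr (Or.inr h)))).exists_program ω x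
    (fun b hb => hb) _ fun q => ?_
  rw [← coeff_kron_code q.1.1.isLt q.2 (expTrunc_mem_regular hreg d)]
  exact ⟨_, code_lt (degree_lt_of_regMonomial q) q.1.1.isLt, rfl⟩

theorem map_tablePoly {S : Type u} [CommRing S] (π : R →+* S) (x : RegMonomial r d → R) :
    (tablePoly x).map (MvPolynomial.map π) = tablePoly (π ∘ x) := by
  rw [tablePoly, Polynomial.map_sum]
  simp_rw [map_monomial, MvPolynomial.map_monomial]
  rfl

theorem map_expTrunc {S : Type u} [CommRing S] (π : R →+* S)
    (hu : ∀ n, 0 < n → n < d → IsUnit (n : R)) (p : (MvPolynomial (Fin r) R)[X]) :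
    (expTrunc d p).map (MvPolynomial.map π) = expTrunc d (p.map (MvPolynomial.map π)) := by
  rw [expTrunc, Polynomial.map_sum]
  refine Finset.sum_congr rfl fun n hn => ?_
  rw [Polynomial.map_mul, Polynomial.map_pow]
  congr 1
  change (C (MvPolynomial.C _)).map _ = C (MvPolynomial.C _)
  rw [map_C, MvPolynomial.map_C,
    map_inverse_of_isUnit π (isUnit_factorial hu (Finset.mem_range.1 hn)), map_natCast]

end Table

/-! ### Comparison with classes modulo `s ^ d` -/

section Quotient

open Polynomial

variable {R : Type u} [CommRing R] {r d : ℕ}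

theorem HasSmallInverses.isUnit (h : HasSmallInverses R d) {n : ℕ} (hn : 0 < n) (hnd : n < d) :
    IsUnit (n : R) := by
  rcases h with ⟨p, hp, hdp, hchar⟩ | ⟨f, -⟩
  · exact (CharP.isUnit_natCast_iff hp).2 fun h => absurd (Nat.le_of_dvd hn h) (by omega)
  · rw [← map_natCast f]
    exact (IsUnit.mk0 (n : ℚ) (by positivity)).map f

/-- The class of a polynomial in `s` modulo `s ^ d`. -/
noncomputable def toSeriesMod (R : Type u) [CommRing R] (r d : ℕ) :
    (MvPolynomial (Fin r) R)[X] →+* SeriesMod R r d :=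
  (Ideal.Quotient.mk _).comp coeToPowerSeries.ringHom

theorem coeffMod_toSeriesMod (n : Fin d) (p : (MvPolynomial (Fin r) R)[X]) :
    coeffMod n (toSeriesMod R r d p) = p.coeff n := by
  rw [toSeriesMod, RingHom.comp_apply, coeffMod_mk, coeToPowerSeries.ringHom_apply, coeff_coe]

theorem seriesMod_ext {f g : SeriesMod R r d} (h : ∀ n, coeffMod n f = coeffMod n g) : f = g := by
  obtain ⟨f, rfl⟩ := Ideal.Quotient.mk_surjective f
  obtain ⟨g, rfl⟩ := Ideal.Quotient.mk_surjective g
  rw [Ideal.Quotient.eq, Ideal.mem_span_singleton, PowerSeries.X_pow_dvd_iff]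
  intro n hn
  rw [map_sub, sub_eq_zero]
  exact h ⟨n, hn⟩

theorem toSeriesMod_tablePoly {h : SeriesMod R r d} (hreg : IsRegularInY h) :
    toSeriesMod R r d (tablePoly (coeffTable h)) = h := by
  refine seriesMod_ext fun n => ?_
  rw [coeffMod_toSeriesMod]
  ext α
  by_cases hα : α.degree ≤ n
  · exact coeff_tablePoly (coeffTable h) ⟨(n, α), hα⟩
  · rw [MvPolynomial.coeff_eq_zero_of_totalDegree_lt, MvPolynomial.coeff_eq_zero_of_totalDegree_lt]
    · exact (hreg n).trans_lt (not_le.1 hα)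
    · exact (tablePoly_mem_regular (coeffTable h) n).trans_lt (not_le.1 hα)

/-- The inverse of `n!` is taken in `R` on one side and in the quotient on the other; they agree
because `n!` is a unit of `R`. -/
theorem toSeriesMod_expTrunc (hu : ∀ n, 0 < n → n < d → IsUnit (n : R))
    (p : (MvPolynomial (Fin r) R)[X]) :
    toSeriesMod R r d (expTrunc d p) = expMod (toSeriesMod R r d p) := by
  rw [expTrunc, expMod, map_sum]
  refine Finset.sum_congr rfl fun n hn => ?_
  rw [map_mul, map_pow]
  congr 1
  have := map_inverse_of_isUnit
    ((toSeriesMod R r d).comp (algebraMap R (MvPolynomial (Fin r) R)[X]))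
    (isUnit_factorial hu (Finset.mem_range.1 hn))
  rwa [map_natCast] at this

theorem coeffMod_expMod (hs : HasSmallInverses R d) {h : SeriesMod R r d} (hreg : IsRegularInY h)
    (n : Fin d) :
    coeffMod n (expMod h) = (expTrunc d (tablePoly (coeffTable h))).coeff n := by
  rw [← coeffMod_toSeriesMod, toSeriesMod_expTrunc (fun _ => hs.isUnit), toSeriesMod_tablePoly hreg]

theorem isRegularInY_expMod (hs : HasSmallInverses R d) {h : SeriesMod R r d}
    (hreg : IsRegularInY h) : IsRegularInY (expMod h) := fun n => by
  rw [coeffMod_expMod hs hreg]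
  exact expTrunc_mem_regular (tablePoly_mem_regular _) d n

theorem coeffTable_eq_zero {hd : 0 < d} {h : SeriesMod R r d} (h0 : coeffMod ⟨0, hd⟩ h = 0)
    (q : RegMonomial r d) (hq : (q.1.1 : ℕ) = 0) : coeffTable h q = 0 := by
  rw [coeffTable, show q.1.1 = ⟨0, hd⟩ from Fin.ext hq, h0, MvPolynomial.coeff_zero]

end Quotient

/-! ### One program for all rings, and the final bound -/

section Uniform

/-- A ring with a choice of roots of unity, and a series whose exponential is to be computed. -/
structure Problem (r d : ℕ) (hd : 0 < d) : Type (u + 1) where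
  R : Type u
  [ring : CommRing R]
  small : HasSmallInverses R d
  ω : ℕ → R
  fft : IsFFTFamily ω
  h : SeriesMod R r d
  zero : coeffMod ⟨0, hd⟩ h = 0
  regular : IsRegularInY h

attribute [instance] Problem.ring

variable {r d : ℕ}

theorem isFFTFamily_pi {J : Type*} {S : J → Type*} [∀ j, CommRing (S j)] {ω : ∀ j, ℕ → S j}
    (h : ∀ j, IsFFTFamily (ω j)) : IsFFTFamily fun k j => ω j k := by
  refine fun k => ⟨funext fun j => (h j k).1, ?_, fun t ht htk => ?_⟩
  · rw [Pi.isUnit_iff]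
    exact fun j => (h j k).2.1
  · rw [mem_nonZeroDivisors_iff_right]
    intro x hx
    funext j
    exact (mem_nonZeroDivisors_iff_right.1 ((h j k).2.2 t ht htk)) _ (congrFun hx j)

/-- One program solves all problems: run it over the product of all the rings. -/
theorem exists_uniform_program (r : ℕ) (hd : 1 < d) :
    ∃ P : Program (RegMonomial r d) (RegMonomial r d),
      P.cost ≤ 561 * Nat.clog 2 (2 * (d * d ^ r)) * (d * d ^ r) ∧
      ∀ (j : Problem.{u} r d (by omega)) (q : RegMonomial r d),
        P.eval j.ω (coeffTable j.h) q = coeffTable (expMod j.h) q := by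
  have hu : ∀ n, 0 < n → n < d → IsUnit (n : ∀ j : Problem.{u} r d (by omega), j.R) := by
    intro n hn hnd
    rw [Pi.isUnit_iff]
    exact fun j => j.small.isUnit hn hnd
  -- The index set consists of all problems, including the choice of `h`, so this single input
  -- contains every input.
  obtain ⟨P, hP, hdiv, hev⟩ := exists_program_exp hd hu
    (isFFTFamily_pi fun j : Problem.{u} r d (by omega) => j.fft)
    (fun q j => coeffTable j.h q) fun q hq => funext fun j => coeffTable_eq_zero j.zero q hq
  refine ⟨P, hP, fun j q => ?_⟩
  have h1 := P.eval_map (Pi.evalRingHom (fun j : Problem.{u} r d (by omega) => j.R) j)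
    (fun k j => j.ω k) (fun q j => coeffTable j.h q) hdiv q
  rw [hev, ← MvPolynomial.coeff_map, ← Polynomial.coeff_map, map_expTrunc _ hu, map_tablePoly] at h1
  rw [coeffTable, coeffMod_expMod j.small j.regular]
  exact h1

/-- Here `4488 = 561 * 8`: the logarithm of `2 * d ^ (r + 1)` costs a factor `2`, and `Nat.clog 2 d
≤ 2 * log d / log 2 ≤ 4 * log d`. -/
theorem cost_bound (r : ℕ) (hd : 1 < d) :
    ((561 * Nat.clog 2 (2 * (d * d ^ r)) * (d * d ^ r) : ℕ) : ℝ) ≤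
      4488 * (((r : ℝ) + 1) * (d : ℝ) ^ (r + 1) * Real.log d) := by
  have hL : 0 < Nat.clog 2 d := Nat.clog_pos one_lt_two hd
  have h1 : Nat.clog 2 (2 * (d * d ^ r)) ≤ 2 * ((r + 1) * Nat.clog 2 d) := by
    have h2 : Nat.clog 2 (2 * (d * d ^ r)) ≤ 1 + Nat.clog 2 d * (r + 1) := by
      refine Nat.clog_le_of_le_pow ?_
      rw [pow_add, pow_one, pow_mul, ← pow_succ']
      exact Nat.mul_le_mul_left 2 (Nat.pow_le_pow_left (Nat.le_pow_clog one_lt_two d) _)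
    have h3 : 1 ≤ Nat.clog 2 d * (r + 1) := Nat.mul_pos hL r.succ_pos
    linarith
  have h4 : (Nat.clog 2 d : ℝ) ≤ 4 * Real.log d := by
    have h5 := Nat.pow_pred_clog_lt_self one_lt_two hd
    obtain ⟨l, hl⟩ := Nat.exists_eq_add_of_le' hL
    rw [hl, Nat.pred_eq_sub_one, Nat.add_sub_cancel] at h5
    have h6 : (l : ℝ) * Real.log 2 ≤ Real.log d := by
      rw [← Real.log_pow]
      exact Real.log_le_log (by positivity) (by exact_mod_cast h5.le)
    have h7 : Real.log 2 ≤ Real.log d := Real.log_le_log two_pos (by exact_mod_cast hd)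
    have h8 := Real.log_two_gt_d9
    have h9 : (0 : ℝ) ≤ l := Nat.cast_nonneg l
    rw [hl]
    push_cast
    nlinarith
  have h10 : (Nat.clog 2 (2 * (d * d ^ r)) : ℝ) ≤ 8 * (((r : ℝ) + 1) * Real.log d) := by
    calc (Nat.clog 2 (2 * (d * d ^ r)) : ℝ) ≤ 2 * (((r : ℝ) + 1) * Nat.clog 2 d) := by
          exact_mod_cast h1
      _ ≤ 2 * (((r : ℝ) + 1) * (4 * Real.log d)) := by gcongr
      _ = _ := by ring
  push_cast
  rw [← pow_succ' (d : ℝ)]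
  calc 561 * (Nat.clog 2 (2 * (d * d ^ r)) : ℝ) * (d : ℝ) ^ (r + 1)
      ≤ 561 * (8 * (((r : ℝ) + 1) * Real.log d)) * (d : ℝ) ^ (r + 1) := by gcongr
    _ = _ := by ring

/-- For `d = 1` the bound contains `log 1 = 0`, so no operation is allowed; the only output is the
constant `1`. -/
theorem exists_program_one (r : ℕ) :
    ∃ P : Program (RegMonomial r 1) (RegMonomial r 1), P.cost = 0 ∧
      ∀ (R : Type u) [CommRing R] (ω : ℕ → R) (h : SeriesMod R r 1) (q : RegMonomial r 1),
        P.eval ω (coeffTable h) q = coeffTable (expMod h) q := by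
  refine ⟨⟨[], fun _ => .one⟩, rfl, fun R _ ω h q => ?_⟩
  have h1 : expMod h = toSeriesMod R r 1 1 := by
    simp [expMod]
  have h2 : q.1.1 = 0 := Subsingleton.elim _ _
  have h3 : q.1.2 = 0 := by
    have := q.2
    rw [h2] at this
    exact (Finsupp.degree_eq_zero_iff _).1 (Nat.le_zero.1 this)
  rw [coeffTable, h1, coeffMod_toSeriesMod, h2, h3]
  simp [Program.eval, Operand.eval]

end Uniform

end RegularExp

theorem mainTheorem4 :
    (∀ (r d : ℕ) (hd : 0 < d) (R : Type u) [CommRing R], RegularExp.HasSmallInverses R d →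
      ∀ h : RegularExp.SeriesMod R r d,
        RegularExp.coeffMod ⟨0, hd⟩ h = 0 → RegularExp.IsRegularInY h →
        RegularExp.IsRegularInY (RegularExp.expMod h)) ∧
    ∃ C : ℝ, ∀ (r d : ℕ) (hd : 0 < d),
      ∃ P : RegularExp.Program (RegularExp.RegMonomial r d) (RegularExp.RegMonomial r d),
        (P.cost : ℝ) ≤ C * (((r : ℝ) + 1) * (d : ℝ) ^ (r + 1) * Real.log (d : ℝ)) ∧
        ∀ (R : Type u) [CommRing R], RegularExp.HasSmallInverses R d →
          ∀ ω : ℕ → R, RegularExp.IsFFTFamily ω →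
          ∀ h : RegularExp.SeriesMod R r d,
            RegularExp.coeffMod ⟨0, hd⟩ h = 0 → RegularExp.IsRegularInY h →
            ∀ q : RegularExp.RegMonomial r d,
              P.eval ω (RegularExp.coeffTable h) q =
                RegularExp.coeffTable (RegularExp.expMod h) q := by
  refine ⟨fun r d _ R _ hs h _ hreg => RegularExp.isRegularInY_expMod hs hreg,
    4488, fun r d hd => ?_⟩
  rcases Nat.lt_or_ge 1 d with h1 | h1
  · obtain ⟨P, hP, hev⟩ := RegularExp.exists_uniform_program.{u} r h1
    exact ⟨P, (Nat.cast_le.2 hP).trans (RegularExp.cost_bound r h1),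
      fun R _ hs ω hω h h0 hreg q => hev ⟨R, hs, ω, hω, h, h0, hreg⟩ q⟩
  · obtain rfl : d = 1 := by omega
    obtain ⟨P, hP, hev⟩ := RegularExp.exists_program_one.{u} r
    exact ⟨P, by simp [hP], fun R _ _ ω _ h _ _ q => hev R ω h q⟩
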